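/- Let $\mathbb F$ be a field, $R=\mathbb F[x_1,\dots,x_n]$, let $<$ be an admissible ordering (monomial order) on the set $\mathbb M$ of monomials of $R$, and write $\mathrm{lt}(p)$, $\mathrm{lc}(p)$ for the head monomial and head coefficient of $p\neq 0$. Let $m\ge 1$ and let $F=(f_1,\dots,f_m)$ be a list of nonzero homogeneous polynomials of $R$. A finite set $G$ is a *Gröbner basis* of an ideal $I$ if $\langle G\rangle=I$ and for every nonzero $p\in I$ there is a nonzero $g\in G$ with $\mathrm{lt}(g)\mid\mathrm{lt}(p)$. A *syzygy* of $F$ is an $H\in R^m$ with $\sum_i H_if_i=0$; the *principal* syzygies are $f_i\mathbf e_j-f_j\mathbf e_i$. The S-polynomial of $p,q$ is $\mathrm{lc}(q)\frac{t}{\mathrm{lt}(p)}p-\mathrm{lc}(p)\frac{t}{\mathrm{lt}(q)}q$ with $t=\mathrm{lcm}(\mathrm{lt}(p),\mathrm{lt}(q))$. *The algorithm F5.* Signatures are pairs $\mu\mathbf e_\nu$ ($\mu\in\mathbb M$, $1\le\nu\le m$), multiplied by monomials through $u\cdot\mu\mathbf e_\nu=(u\mu)\mathbf e_\nu$ and ordered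 by $\nu$, then by $\mu$. F5 keeps a list of labeled polynomials $r_k=(\mathrm{sig}(k),\mathrm{poly}(k))$ and, for each $\nu$, a list $\mathrm{Rules}_\nu$ of pairs $(\mu,k)$, initially empty. The multiple $(u,k)$, where $\mathrm{sig}(k)=\mu\mathbf e_\nu$, is *rewritable* if the most recently added $(\mu',j)\in\mathrm{Rules}_\nu$ with $\mu'\mid u\mu$ exists and has $j\ne k$. A monomial is *top-reducible* by a set of positions if it is divisible by $\mathrm{lt}(\mathrm{poly}(\ell))$ for some position $\ell$ in the set. Choices that are left open below (ties, order of traversal of a set) are made arbitrarily. - *Main loop.* Sort $F$ by increasing total degree, breaking ties by increasing head monomial. Put $r_1=(\mathbf e_1,f_1/\mathrm{lc}(f_1))$, $G_{\rm prev}=\{1\}$, $B=\{f_1\}$. For $i=2,\dots,m$: append $(\mathbf e_i,f_i/\mathrm{lc}(f_i))$ to $r$ and compute $G_{\rm curr}$ from $G_{\rm prev},B$ by the next item; if $\mathrm{poly}(\lambda)=1$ for some $\lambda\in G_{\rm curr}$, return $\{1\}$; otherwise put $G_{\rm prev}:=G_{\rm curr}$ and $B:=\{\mathrm{poly}(\lambda):\lambda\in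 G_{\rm prev}\}$. At the end return $B$. - *Partial basis.* Let $c$ be the position of $f_i/\mathrm{lc}(f_i)$. Put $G_{\rm curr}:=G_{\rm prev}\cup\{c\}$ and let $P$ be the set of critical pairs of $(c,j)$, $j\in G_{\rm prev}$. While $P\ne\emptyset$: remove from $P$ its elements $(t,k,u,\ell,v)$ with $\deg t$ minimal, pass them to "S-polynomials" and the result to "Reduction"; for each $k$ in the output of the latter, add to $P$ the critical pairs of $(k,j)$, $j\in G_{\rm curr}$, then add $k$ to $G_{\rm curr}$. Return $G_{\rm curr}$. - *Critical pair of $(k,\ell)$.* Let $t=\mathrm{lcm}(\mathrm{lt}(\mathrm{poly}(k)),\mathrm{lt}(\mathrm{poly}(\ell)))$, $u=t/\mathrm{lt}(\mathrm{poly}(k))$, $v=t/\mathrm{lt}(\mathrm{poly}(\ell))$. There is none if $u\,\mathrm{sig}(k)$ or $v\,\mathrm{sig}(\ell)$ has index $i$ and its monomial is top-reducible by $G_{\rm prev}$. Otherwise it is $(t,k,u,\ell,v)$, or $(t,\ell,v,k,u)$ if $u\,\mathrm{sig}(k)<v\,\mathrm{sig}(\ell)$. - *S-polynomials.* For the given pairs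 $(t,k,u,\ell,v)$, by increasing $t$: if neither $(u,k)$ nor $(v,\ell)$ is rewritable, let $s$ be the S-polynomial of $\mathrm{poly}(k),\mathrm{poly}(\ell)$, append $(u\,\mathrm{sig}(k),s)$ to $r$ and the corresponding rule (monomial of the signature, new position) to the rules of its index. Return the set of the new positions with $s\neq0$. - *Reduction.* Let $T$ be the given set and $D=\emptyset$. While $T\ne\emptyset$: remove from $T$ a $k$ of minimal signature, replace $\mathrm{poly}(k)$ by a normal form modulo $B$, and top-reduce $k$: (a) if $\mathrm{poly}(k)=0$, do nothing more (a *reduction to zero*). Otherwise call $j\in G_{\rm curr}\cup D$ a reductor if $\mathrm{lt}(\mathrm{poly}(j))\mid\mathrm{lt}(\mathrm{poly}(k))$ and, with $w$ the quotient, $w\,\mathrm{sig}(j)\ne\mathrm{sig}(k)$, $(w,j)$ is not rewritable, and the monomial of $w\,\mathrm{sig}(j)$ is not top-reducible by $G_{\rm prev}$. (b) If there is no reductor, make $\mathrm{poly}(k)$ monic and put $k$ into $D$. (c) Otherwise choose a reductor $j$ and let $p=\mathrm{poly}(k)-\frac{\mathrm{lc}(\mathrm{poly}(k))}{\mathrm{lc}(\mathrm{poly}(j))}w\,\mathrm{poly}(j)$,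 made monic if it is nonzero. If $w\,\mathrm{sig}(j)<\mathrm{sig}(k)$, replace $\mathrm{poly}(k)$ by $p$ and put $k$ back into $T$; if not, append $(w\,\mathrm{sig}(j),p)$ to $r$ and the corresponding rule to the rules, and put $k$ and the new position into $T$. Return $D$ when $T=\emptyset$. *Claim.* (1) Whenever a run of F5 on $F$ terminates, its output is a Gröbner basis of $\langle f_1,\dots,f_m\rangle$ with respect to $<$. (2) If every syzygy of $F$ is an $R$-linear combination of principal syzygies, then no run of F5 on $F$, terminating or not, performs a reduction to zero: case (a) never occurs, and no S-polynomial computed in the step "S-polynomials" is zero. -/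

import Mathlib

open MvPolynomial

/-- `G` is a Gröbner basis of the ideal `I` with respect to `ord`: a finite set of elements of `I`
that generates `I`, such that the head monomial of every nonzero `p ∈ I` is divisible by the head
monomial of some (nonzero) `g ∈ G`.  Monomials are identified with exponent vectors, so that
divisibility is `≤`. -/
structure IsGroebnerBasis {K : Type*} [Field K] {n : ℕ} (ord : MonomialOrder (Fin n))
    (G : Set (MvPolynomial (Fin n) K)) (I : Ideal (MvPolynomial (Fin n) K)) : Prop where
  finite : G.Finite
  span_eq : Ideal.span G = I
  exists_dvd : ∀ p ∈ I, p ≠ 0 → ∃ g ∈ G, g ≠ 0 ∧ ord.degree g ≤ ord.degree p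

/-- `H` is a syzygy of `F`. -/
def IsSyzygy {K : Type*} [Field K] {n m : ℕ} (F H : Fin m → MvPolynomial (Fin n) K) : Prop :=
  ∑ i, H i * F i = 0

/-- The principal syzygies `f_i e_j - f_j e_i` of `F`. -/
def principalSyzygies {K : Type*} [Field K] {n m : ℕ} (F : Fin m → MvPolynomial (Fin n) K) :
    Set (Fin m → MvPolynomial (Fin n) K) :=
  {H | ∃ i j : Fin m, H = Pi.single j (F i) - Pi.single i (F j)}

namespace F5

/-! The algorithm F5 as a nondeterministic transition system: whenever the pseudocode leaves a
choice open (ties in a sort, the order in which a set is traversed), every choice is allowed.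
Generators, signature indices and positions in the list of labeled polynomials are counted
from `0`. -/

/-- Power products, as exponent vectors; the product is `+`, divisibility is `≤`. -/
abbrev Mon (n : ℕ) := Fin n →₀ ℕ

/-- A signature `μ e_ν`. -/
abbrev Sig (n m : ℕ) := Mon n × Fin m

/-- The product of a monomial and a signature. -/
noncomputable def Sig.mul {n m : ℕ} (u : Mon n) (s : Sig n m) : Sig n m := (u + s.1, s.2)

/-- The strict ordering of signatures: first by index, then by monomial. -/
def Sig.Lt {n m : ℕ} (ord : MonomialOrder (Fin n)) (s t : Sig n m) : Prop :=
  s.2 < t.2 ∨ (s.2 = t.2 ∧ ord.toSyn s.1 < ord.toSyn t.1)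

/-- The global variables: the list of labeled polynomials (the entries at `0, …, size - 1`; the
values of `entry` from `size` on are irrelevant) and, for each index, the list of rewrite rules,
in the order in which they were added. -/
structure Memory (K : Type*) [Field K] (n m : ℕ) where
  entry : ℕ → Sig n m × MvPolynomial (Fin n) K
  size : ℕ
  rules : Fin m → List (Mon n × ℕ)

namespace Memory

variable {K : Type*} [Field K] {n m : ℕ}

def sig (M : Memory K n m) (k : ℕ) : Sig n m := (M.entry k).1

def poly (M : Memory K n m) (k : ℕ) : MvPolynomial (Fin n) K := (M.entry k).2

/-- Append a labeled polynomial; its position is the old `size`. -/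
def append (M : Memory K n m) (s : Sig n m) (p : MvPolynomial (Fin n) K) : Memory K n m :=
  { M with entry := Function.update M.entry M.size (s, p), size := M.size + 1 }

/-- Replace the polynomial at position `k`, keeping its signature. -/
def setPoly (M : Memory K n m) (k : ℕ) (p : MvPolynomial (Fin n) K) : Memory K n m :=
  { M with entry := Function.update M.entry k (M.sig k, p) }

/-- `Add_Rule`. -/
def addRule (M : Memory K n m) (s : Sig n m) (k : ℕ) : Memory K n m :=
  { M with rules := Function.update M.rules s.2 (M.rules s.2 ++ [(s.1, k)]) }

/-- Append a labeled polynomial and record the corresponding rule. -/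
def appendWithRule (M : Memory K n m) (s : Sig n m) (p : MvPolynomial (Fin n) K) :
    Memory K n m :=
  (M.append s p).addRule s M.size

open Classical in
/-- `Find_Rewriting`: search the rules of the index of `sig k`, the most recent one first, for a
rule whose monomial divides that of `u * sig k`; return `k` if there is none. -/
noncomputable def findRewriting (M : Memory K n m) (u : Mon n) (k : ℕ) : ℕ :=
  match (M.rules (M.sig k).2).reverse.find? (fun ρ => decide (ρ.1 ≤ u + (M.sig k).1)) with
  | some ρ => ρ.2
  | none => k

/-- `Is_Rewritable`. -/
def IsRewritable (M : Memory K n m) (u : Mon n) (k : ℕ) : Prop := M.findRewriting u k ≠ k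

/-- The monomial `t` is top-reducible by the polynomials with positions in `prev`. -/
def TopReducible (M : Memory K n m) (ord : MonomialOrder (Fin n)) (prev : Finset ℕ)
    (t : Mon n) : Prop :=
  ∃ l ∈ prev, ord.degree (M.poly l) ≤ t

end Memory

/-- A critical pair `(t, k, u, ℓ, v)`. -/
structure CritPair (n : ℕ) where
  t : Mon n
  k : ℕ
  u : Mon n
  l : ℕ
  v : Mon n
deriving DecidableEq

section

variable {K : Type*} [Field K] {n m : ℕ}

/-- `p` divided by its head coefficient. -/
noncomputable def monic (ord : MonomialOrder (Fin n)) (p : MvPolynomial (Fin n) K) :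
    MvPolynomial (Fin n) K :=
  C (ord.leadingCoeff p)⁻¹ * p

open Classical in
/-- `Critical_Pair`. -/
noncomputable def critPair (ord : MonomialOrder (Fin n)) (M : Memory K n m) (k l : ℕ)
    (i : Fin m) (prev : Finset ℕ) : Finset (CritPair n) :=
  let tk := ord.degree (M.poly k)
  let tl := ord.degree (M.poly l)
  let t := tk ⊔ tl
  let u₁ := t - tk
  let u₂ := t - tl
  if (M.sig k).2 = i ∧ M.TopReducible ord prev (u₁ + (M.sig k).1) then ∅
  else if (M.sig l).2 = i ∧ M.TopReducible ord prev (u₂ + (M.sig l).1) then ∅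
  else if Sig.Lt ord (Sig.mul u₁ (M.sig k)) (Sig.mul u₂ (M.sig l)) then {⟨t, l, u₂, k, u₁⟩}
  else {⟨t, k, u₁, l, u₂⟩}

/-- One reduction step modulo `B`: some term of `p` is cancelled with a multiple of some
`b ∈ B`. -/
def ReduceStep (ord : MonomialOrder (Fin n)) (B : Set (MvPolynomial (Fin n) K))
    (p q : MvPolynomial (Fin n) K) : Prop :=
  ∃ b ∈ B, b ≠ 0 ∧ ∃ s ∈ p.support, ord.degree b ≤ s ∧
    q = p - monomial (s - ord.degree b) (p.coeff s * (ord.leadingCoeff b)⁻¹) * b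

/-- `h` is a normal form of `p` modulo `B`: it arises from `p` by finitely many reduction steps,
and none of its terms can be reduced. -/
def IsNormalForm (ord : MonomialOrder (Fin n)) (B : Set (MvPolynomial (Fin n) K))
    (p h : MvPolynomial (Fin n) K) : Prop :=
  Relation.ReflTransGen (ReduceStep ord B) p h ∧ ∀ q, ¬ ReduceStep ord B h q

/-- The condition under which `Find_Reductor` may return `j`, when it is called for `k` with
previous basis `prev` and current generators `gens`. -/
def IsReductor (ord : MonomialOrder (Fin n)) (M : Memory K n m) (k : ℕ) (prev gens : Finset ℕ)
    (j : ℕ) : Prop :=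
  j ∈ gens ∧ ord.degree (M.poly j) ≤ ord.degree (M.poly k) ∧
    Sig.mul (ord.degree (M.poly k) - ord.degree (M.poly j)) (M.sig j) ≠ M.sig k ∧
    ¬ M.IsRewritable (ord.degree (M.poly k) - ord.degree (M.poly j)) j ∧
    ¬ M.TopReducible ord prev (ord.degree (M.poly k) - ord.degree (M.poly j) + (M.sig j).1)

open Classical in
/-- The result `p - c u q` of a top-reduction of `p` by `q`, made monic if it is nonzero. -/
noncomputable def topReduct (ord : MonomialOrder (Fin n)) (p q : MvPolynomial (Fin n) K) :
    MvPolynomial (Fin n) K :=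
  let r := p - monomial (ord.degree p - ord.degree q)
    (ord.leadingCoeff p * (ord.leadingCoeff q)⁻¹) * q
  if r = 0 then 0 else monic ord r

end

/-- The local variables of a run of `Partial_Basis`: the index `i` of the generator that is being
added, the Gröbner basis `B` of the ideal of the previous generators, the positions `prev` of its
elements, the positions `cur` of the current generators, and the critical pairs that remain. -/
structure Frame (K : Type*) [Field K] (n m : ℕ) where
  i : Fin m
  B : Set (MvPolynomial (Fin n) K)
  prev : Finset ℕ
  cur : Finset ℕ
  pairs : Finset (CritPair n)

/-- The control states of the algorithm. -/
inductive Config (K : Type*) [Field K] (n m : ℕ)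
  /-- At the head of the loop of the main algorithm. -/
  | basis (M : Memory K n m) (i : ℕ) (prev : Finset ℕ) (B : Set (MvPolynomial (Fin n) K))
  /-- At the head of the loop of `Partial_Basis`. -/
  | partialBasis (M : Memory K n m) (f : Frame K n m)
  /-- In the loop of `S_Pols`, with the list of critical pairs that remain to be considered and
  the positions of the new nonzero `S`-polynomials. -/
  | spols (M : Memory K n m) (f : Frame K n m) (rest : List (CritPair n)) (newpols : Finset ℕ)
  /-- At the head of the loop of `Reduction`. -/
  | reduction (M : Memory K n m) (f : Frame K n m) (todo completed : Finset ℕ)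
  /-- At the start of a call of `Top_Reduction` for `k`. -/
  | topReduction (M : Memory K n m) (f : Frame K n m) (todo completed : Finset ℕ) (k : ℕ)
  /-- In the loop of `Partial_Basis` over the output of `Reduction`. -/
  | update (M : Memory K n m) (f : Frame K n m) (reduced : Finset ℕ)
  /-- The algorithm has returned `G`. -/
  | halted (G : Set (MvPolynomial (Fin n) K))

section

variable {K : Type*} [Field K] {n m : ℕ}

/-- One step of F5 on the (already sorted) input `F`. -/
inductive Step (ord : MonomialOrder (Fin n)) (F : Fin m → MvPolynomial (Fin n) K) :
    Config K n m → Config K n m → Prop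
  /-- The main loop ends. -/
  | basis_return (M : Memory K n m) (i : ℕ) (prev : Finset ℕ)
      (B : Set (MvPolynomial (Fin n) K)) (hi : m ≤ i) :
      Step ord F (.basis M i prev B) (.halted B)
  /-- The next generator is appended and `Partial_Basis` starts. -/
  | basis_next (M M' : Memory K n m) (i : ℕ) (prev : Finset ℕ)
      (B : Set (MvPolynomial (Fin n) K)) (hi : i < m)
      (hM' : M' = M.append (0, ⟨i, hi⟩) (monic ord (F ⟨i, hi⟩))) :
      Step ord F (.basis M i prev B)
        (.partialBasis { M' with rules := Function.update M'.rules ⟨i, hi⟩ [] }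
          { i := ⟨i, hi⟩, B := B, prev := prev, cur := insert M.size prev,
            pairs := prev.biUnion fun j => critPair ord M' M.size j ⟨i, hi⟩ prev })
  /-- `Partial_Basis` ends, with `1` in the basis. -/
  | partial_return_one (M : Memory K n m) (f : Frame K n m) (hP : f.pairs = ∅)
      (h1 : ∃ l ∈ f.cur, M.poly l = 1) :
      Step ord F (.partialBasis M f) (.halted {1})
  /-- `Partial_Basis` ends, without `1` in the basis. -/
  | partial_return (M : Memory K n m) (f : Frame K n m) (hP : f.pairs = ∅)
      (h1 : ¬ ∃ l ∈ f.cur, M.poly l = 1) :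
      Step ord F (.partialBasis M f)
        (.basis M (f.i + 1) f.cur {p | ∃ l ∈ f.cur, M.poly l = p})
  /-- The critical pairs of minimal degree are passed to `S_Pols`, by increasing lcm. -/
  | partial_select (M : Memory K n m) (f : Frame K n m) (d : ℕ) (L : List (CritPair n))
      (hd : IsLeast {e | ∃ p ∈ f.pairs, p.t.degree = e} d)
      (hnodup : L.Nodup) (hL : ∀ p, p ∈ L ↔ p ∈ f.pairs ∧ p.t.degree = d)
      (hsort : L.Pairwise fun p q => ord.toSyn p.t ≤ ord.toSyn q.t) :
      Step ord F (.partialBasis M f)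
        (.spols M { f with pairs := f.pairs.filter fun p => p.t.degree ≠ d } L ∅)
  /-- `S_Pols` disregards a critical pair with a rewritable component. -/
  | spols_skip (M : Memory K n m) (f : Frame K n m) (p : CritPair n) (L : List (CritPair n))
      (newpols : Finset ℕ) (h : M.IsRewritable p.u p.k ∨ M.IsRewritable p.v p.l) :
      Step ord F (.spols M f (p :: L) newpols) (.spols M f L newpols)
  /-- `S_Pols` computes a zero `S`-polynomial. -/
  | spols_zero (M : Memory K n m) (f : Frame K n m) (p : CritPair n) (L : List (CritPair n))
      (newpols : Finset ℕ) (hk : ¬ M.IsRewritable p.u p.k) (hl : ¬ M.IsRewritable p.v p.l)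
      (hs : ord.sPolynomial (M.poly p.k) (M.poly p.l) = 0) :
      Step ord F (.spols M f (p :: L) newpols)
        (.spols (M.appendWithRule (Sig.mul p.u (M.sig p.k)) 0) f L newpols)
  /-- `S_Pols` computes a nonzero `S`-polynomial. -/
  | spols_add (M : Memory K n m) (f : Frame K n m) (p : CritPair n) (L : List (CritPair n))
      (newpols : Finset ℕ) (hk : ¬ M.IsRewritable p.u p.k) (hl : ¬ M.IsRewritable p.v p.l)
      (hs : ord.sPolynomial (M.poly p.k) (M.poly p.l) ≠ 0) :
      Step ord F (.spols M f (p :: L) newpols)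
        (.spols (M.appendWithRule (Sig.mul p.u (M.sig p.k))
          (ord.sPolynomial (M.poly p.k) (M.poly p.l))) f L (insert M.size newpols))
  /-- `S_Pols` ends and `Reduction` starts. -/
  | spols_return (M : Memory K n m) (f : Frame K n m) (newpols : Finset ℕ) :
      Step ord F (.spols M f [] newpols) (.reduction M f newpols ∅)
  /-- `Reduction` selects an element of minimal signature, replaces its polynomial by a normal
  form and calls `Top_Reduction`. -/
  | reduction_select (M : Memory K n m) (f : Frame K n m) (todo completed : Finset ℕ) (k : ℕ)
      (h : MvPolynomial (Fin n) K) (hk : k ∈ todo)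
      (hmin : ∀ j ∈ todo, ¬ Sig.Lt ord (M.sig j) (M.sig k))
      (hnf : IsNormalForm ord f.B (M.poly k) h) :
      Step ord F (.reduction M f todo completed)
        (.topReduction (M.setPoly k h) f (todo.erase k) completed k)
  /-- `Reduction` ends. -/
  | reduction_return (M : Memory K n m) (f : Frame K n m) (completed : Finset ℕ) :
      Step ord F (.reduction M f ∅ completed) (.update M f completed)
  /-- Reduction to zero. -/
  | top_zero (M : Memory K n m) (f : Frame K n m) (todo completed : Finset ℕ) (k : ℕ)
      (hk : M.poly k = 0) :
      Step ord F (.topReduction M f todo completed k) (.reduction M f todo completed)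
  /-- There is no reductor. -/
  | top_complete (M : Memory K n m) (f : Frame K n m) (todo completed : Finset ℕ) (k : ℕ)
      (hk : M.poly k ≠ 0) (hJ : ∀ j, ¬ IsReductor ord M k f.prev (f.cur ∪ completed) j) :
      Step ord F (.topReduction M f todo completed k)
        (.reduction (M.setPoly k (monic ord (M.poly k))) f todo (insert k completed))
  /-- Top-reduction by a reductor of smaller signature. -/
  | top_safe (M : Memory K n m) (f : Frame K n m) (todo completed : Finset ℕ) (k j : ℕ)
      (u : Mon n) (hk : M.poly k ≠ 0) (hj : IsReductor ord M k f.prev (f.cur ∪ completed) j)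
      (hu : u = ord.degree (M.poly k) - ord.degree (M.poly j))
      (hs : Sig.Lt ord (Sig.mul u (M.sig j)) (M.sig k)) :
      Step ord F (.topReduction M f todo completed k)
        (.reduction (M.setPoly k (topReduct ord (M.poly k) (M.poly j))) f
          (insert k todo) completed)
  /-- Top-reduction by a reductor of larger signature, which creates a new labeled
  polynomial. -/
  | top_unsafe (M : Memory K n m) (f : Frame K n m) (todo completed : Finset ℕ) (k j : ℕ)
      (u : Mon n) (hk : M.poly k ≠ 0) (hj : IsReductor ord M k f.prev (f.cur ∪ completed) j)
      (hu : u = ord.degree (M.poly k) - ord.degree (M.poly j))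
      (hs : ¬ Sig.Lt ord (Sig.mul u (M.sig j)) (M.sig k)) :
      Step ord F (.topReduction M f todo completed k)
        (.reduction (M.appendWithRule (Sig.mul u (M.sig j))
          (topReduct ord (M.poly k) (M.poly j))) f (insert k (insert M.size todo)) completed)
  /-- The critical pairs of a new element with the current generators are formed. -/
  | update_next (M : Memory K n m) (f : Frame K n m) (reduced : Finset ℕ) (k : ℕ)
      (hk : k ∈ reduced) :
      Step ord F (.update M f reduced)
        (.update M { f with
            pairs := f.pairs ∪ f.cur.biUnion fun j => critPair ord M k j f.i f.prev
            cur := insert k f.cur } (reduced.erase k))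
  /-- All new elements have been considered. -/
  | update_return (M : Memory K n m) (f : Frame K n m) :
      Step ord F (.update M f ∅) (.partialBasis M f)

/-- The state of F5 on the (already sorted) input `F` when its main loop is entered. -/
noncomputable def start [NeZero m] (ord : MonomialOrder (Fin n))
    (F : Fin m → MvPolynomial (Fin n) K) : Config K n m :=
  .basis { entry := fun _ => ((0, 0), monic ord (F 0)), size := 1, rules := fun _ => [] }
    1 {0} {F 0}

/-- Sorted by increasing total degree, and by increasing head monomial within a degree. -/
def IsSorted (ord : MonomialOrder (Fin n)) (F : Fin m → MvPolynomial (Fin n) K) : Prop :=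
  ∀ i j, i < j → (F i).totalDegree < (F j).totalDegree ∨
    ((F i).totalDegree = (F j).totalDegree ∧
      ord.toSyn (ord.degree (F i)) ≤ ord.toSyn (ord.degree (F j)))

/-- Some run of F5 on the input `F`, which begins by sorting `F`, reaches the state `c`. -/
def Reaches [NeZero m] (ord : MonomialOrder (Fin n)) (F : Fin m → MvPolynomial (Fin n) K)
    (c : Config K n m) : Prop :=
  ∃ π : Equiv.Perm (Fin m), IsSorted ord (F ∘ π) ∧
    Relation.ReflTransGen (Step ord (F ∘ π)) (start ord (F ∘ π)) c

/-- Some run of F5 on the input `F` terminates with output `G`. -/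
def Outputs [NeZero m] (ord : MonomialOrder (Fin n)) (F : Fin m → MvPolynomial (Fin n) K)
    (G : Set (MvPolynomial (Fin n) K)) : Prop :=
  Reaches ord F (.halted G)

/-- The state in which a reduction to zero takes place: `Top_Reduction` is called for a polynomial
that has become zero, or `S_Pols` computes an `S`-polynomial that is zero. -/
inductive IsZeroReduction (ord : MonomialOrder (Fin n)) : Config K n m → Prop
  | top (M : Memory K n m) (f : Frame K n m) (todo completed : Finset ℕ) (k : ℕ)
      (hk : M.poly k = 0) : IsZeroReduction ord (.topReduction M f todo completed k)
  | spols (M : Memory K n m) (f : Frame K n m) (p : CritPair n) (L : List (CritPair n))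
      (newpols : Finset ℕ) (hk : ¬ M.IsRewritable p.u p.k) (hl : ¬ M.IsRewritable p.v p.l)
      (hs : ord.sPolynomial (M.poly p.k) (M.poly p.l) = 0) :
      IsZeroReduction ord (.spols M f (p :: L) newpols)

/-- Some run of F5 on the input `F`, terminating or not, performs a reduction to zero. -/
def ReducesToZero [NeZero m] (ord : MonomialOrder (Fin n))
    (F : Fin m → MvPolynomial (Fin n) K) : Prop :=
  ∃ c, Reaches ord F c ∧ IsZeroReduction ord c

end

end F5

/-! The proof follows vectors instead of polynomials. A polynomial has label `s` if it is the image
of a vector whose last nonzero component has the index and the head monomial recorded in `s`. All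
operations of F5 preserve truth of labels: S-polynomials and top-reductions combine two multiples of
different signature and keep the larger one, and a normal form modulo the previous basis alters only
components of lower index.

Claim (1) rests on the covering property `MinCover`. Let `s` be the least label of any polynomial
with a given head monomial; then zero does not have label `s`. The most recent rule that applies to
`s` (or the generator, if there is none) gives a multiple of signature `s` that is not rewritten. If
its head monomial is not the desired one, it is too large, and the difference of the two polynomials
has a smaller label and the same, too large, head monomial. By induction on signatures that monomial
is also attained by an unrewritten multiple of smaller signature. The critical pair of the two
elements involved was discarded by the criterion or has a rewritten component; both properties pass
to multiples, a contradiction (`minCover_of_resolved`). It does not matter what becomes of an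
S-polynomial: computing it adds a rule with the signature of the larger component, so the pair is
rewritten from then on (`StageInv.processPair`). Hence covering holds as soon as no pair is pending,
and with it the Gröbner basis property.

For claim (2), every S-polynomial or reduced polynomial has a signature of the current index `i`
whose monomial is not top-reducible by the previous basis. If the polynomial were zero, there would
be a syzygy with such a leading component `g`. But `g` lies in the ideal of the preceding
generators, so its head monomial is top-reducible. That membership needs the hypothesis on syzygies
for initial segments of the list. It descends by a graded Nakayama argument: if the first Koszul
homology of the longer segment vanishes, multiplication by its last member, homogeneous of positive
degree, is surjective on that of the shorter one, which must vanish (`KoszulExact.of_succ`). -/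

namespace F5

/-! ### The well-founded total order on signatures -/

section Signatures

variable {n m : ℕ} {ord : MonomialOrder (Fin n)}

theorem Sig.lt_wellFounded (ord : MonomialOrder (Fin n)) :
    WellFounded (Sig.Lt (m := m) ord) := by
  have h := InvImage.wf (fun s : Sig n m => (s.2, ord.toSyn s.1))
    (WellFounded.prod_lex (wellFounded_lt (α := Fin m)) (wellFounded_lt (α := ord.syn)))
  refine Subrelation.wf (fun {s t} hst => ?_) h
  exact Prod.lex_def.2 hst

theorem Sig.Lt.trans {s t u : Sig n m} (h : Sig.Lt ord s t) (h' : Sig.Lt ord t u) :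
    Sig.Lt ord s u := by
  rcases h with h | ⟨h, h2⟩ <;> rcases h' with h' | ⟨h', h2'⟩
  · exact .inl (h.trans h')
  · exact .inl (h' ▸ h)
  · exact .inl (h ▸ h')
  · exact .inr ⟨h.trans h', h2.trans h2'⟩

theorem Sig.Lt.irrefl (s : Sig n m) : ¬ Sig.Lt ord s s := by
  simp [Sig.Lt]

theorem Sig.lt_or_eq_or_gt (ord : MonomialOrder (Fin n)) (s t : Sig n m) :
    Sig.Lt ord s t ∨ s = t ∨ Sig.Lt ord t s := by
  rcases lt_trichotomy s.2 t.2 with h | h | h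
  · exact .inl (.inl h)
  · rcases lt_trichotomy (ord.toSyn s.1) (ord.toSyn t.1) with h' | h' | h'
    · exact .inl (.inr ⟨h, h'⟩)
    · exact .inr (.inl (Prod.ext (ord.toSyn.injective h') h))
    · exact .inr (.inr (.inr ⟨h.symm, h'⟩))
  · exact .inr (.inr (.inl h))

theorem Sig.Lt.index_le {s t : Sig n m} (h : Sig.Lt ord s t) : s.2 ≤ t.2 :=
  h.elim le_of_lt fun h => h.1.le

end Signatures

/-! ### Signatures as leading terms of vectors -/

section Labels

variable {K : Type*} [Field K] {n m : ℕ} {ord : MonomialOrder (Fin n)}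
  {F : Fin m → MvPolynomial (Fin n) K}

/-- `s` is the leading signature of the vector `h`. -/
def HasSig (ord : MonomialOrder (Fin n)) (h : Fin m → MvPolynomial (Fin n) K) (s : Sig n m) :
    Prop :=
  h s.2 ≠ 0 ∧ ord.degree (h s.2) = s.1 ∧ ∀ j, s.2 < j → h j = 0

/-- `p` is the image of some vector with leading signature `s`. -/
def Labels (ord : MonomialOrder (Fin n)) (F : Fin m → MvPolynomial (Fin n) K) (s : Sig n m)
    (p : MvPolynomial (Fin n) K) : Prop :=
  ∃ h : Fin m → MvPolynomial (Fin n) K, HasSig ord h s ∧ ∑ j, h j * F j = p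

/-- The ideal generated by the first `i` members of `F`. -/
noncomputable def partialIdeal (F : Fin m → MvPolynomial (Fin n) K) (i : ℕ) : Ideal (MvPolynomial (Fin n) K) :=
  Ideal.span (F '' {j | (j : ℕ) < i})

theorem mem_partialIdeal {i : ℕ} {p : MvPolynomial (Fin n) K} :
    p ∈ partialIdeal F i ↔
      ∃ h : Fin m → MvPolynomial (Fin n) K, (∀ j : Fin m, i ≤ (j : ℕ) → h j = 0) ∧ ∑ j, h j * F j = p := by
  classical
  constructor
  · intro hp
    refine Submodule.span_induction (p := fun p _ => ∃ h : Fin m → MvPolynomial (Fin n) K,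
      (∀ j : Fin m, i ≤ (j : ℕ) → h j = 0) ∧ ∑ j, h j * F j = p) ?_ ?_ ?_ ?_ hp
    · rintro _ ⟨j, hj, rfl⟩
      refine ⟨Pi.single j 1, fun k hk => ?_, ?_⟩
      · rw [Pi.single_eq_of_ne]
        rintro rfl
        exact absurd hj (not_lt.2 hk)
      · rw [Finset.sum_eq_single j] <;> simp +contextual
    · exact ⟨0, by simp, by simp⟩
    · rintro _ _ _ _ ⟨g, hg, rfl⟩ ⟨h, hh, rfl⟩
      exact ⟨g + h, fun j hj => by simp [hg j hj, hh j hj], by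
        simp [add_mul, Finset.sum_add_distrib]⟩
    · rintro a _ _ ⟨g, hg, rfl⟩
      exact ⟨fun j => a * g j, fun j hj => by simp [hg j hj], by
        simp [mul_assoc, Finset.mul_sum]⟩
  · rintro ⟨h, hh, rfl⟩
    refine Ideal.sum_mem _ fun j _ => ?_
    by_cases hj : (j : ℕ) < i
    · exact Ideal.mul_mem_left _ _ (Ideal.subset_span ⟨j, hj, rfl⟩)
    · simp [hh j (not_lt.1 hj)]

theorem partialIdeal_mono {i j : ℕ} (h : i ≤ j) : partialIdeal F i ≤ partialIdeal F j :=
  Ideal.span_mono (Set.image_mono fun _ hk => lt_of_lt_of_le hk h)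

theorem exists_hasSig {h : Fin m → MvPolynomial (Fin n) K} (hh : h ≠ 0) :
    ∃ s, HasSig ord h s := by
  classical
  obtain ⟨j, hj⟩ := Function.ne_iff.1 hh
  let S : Finset (Fin m) := Finset.univ.filter fun j => h j ≠ 0
  have hS : S.Nonempty := ⟨j, by simpa [S] using hj⟩
  have hmem := S.max'_mem hS
  refine ⟨(ord.degree (h (S.max' hS)), S.max' hS), ?_, rfl, fun k hk => ?_⟩
  · simpa [S] using hmem
  · by_contra hne
    exact absurd (S.le_max' k (by simpa [S] using hne)) (not_le.2 hk)

theorem exists_labels_of_mem_partialIdeal {i : ℕ} {p : MvPolynomial (Fin n) K}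
    (hp : p ∈ partialIdeal F i) (h0 : p ≠ 0) :
    ∃ s : Sig n m, (s.2 : ℕ) < i ∧ Labels ord F s p := by
  obtain ⟨h, hh, rfl⟩ := mem_partialIdeal.1 hp
  have : h ≠ 0 := by
    rintro rfl
    simp at h0
  obtain ⟨s, hs⟩ := exists_hasSig (ord := ord) this
  exact ⟨s, not_le.1 fun hle => hs.1 (hh _ hle), h, hs, rfl⟩

theorem Labels.mem_partialIdeal {s : Sig n m} {p : MvPolynomial (Fin n) K}
    (h : Labels ord F s p) : p ∈ partialIdeal F (s.2 + 1) := by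
  obtain ⟨g, hg, rfl⟩ := h
  exact F5.mem_partialIdeal.2 ⟨g, fun j hj => hg.2.2 j (Fin.lt_def.2 hj), rfl⟩

theorem degree_monomial_mul (u : Mon n) {c : K} (hc : c ≠ 0) {p : MvPolynomial (Fin n) K}
    (hp : p ≠ 0) : ord.degree (monomial u c * p) = u + ord.degree p := by
  classical
  rw [ord.degree_mul (by simpa using hc) hp, ord.degree_monomial, if_neg hc]

theorem Labels.monomial_mul {s : Sig n m} {p : MvPolynomial (Fin n) K} (h : Labels ord F s p)
    (u : Mon n) {c : K} (hc : c ≠ 0) : Labels ord F (Sig.mul u s) (monomial u c * p) := by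
  obtain ⟨g, ⟨h1, h2, h3⟩, rfl⟩ := h
  have hm : monomial u c ≠ 0 := by simpa using hc
  refine ⟨fun j => monomial u c * g j, ⟨mul_ne_zero hm h1, ?_, fun j hj => ?_⟩, ?_⟩
  · change ord.degree (monomial u c * g s.2) = u + s.1
    rw [degree_monomial_mul u hc h1, h2]
  · simp [h3 j hj]
  · simp [Finset.mul_sum, mul_assoc]

theorem Labels.C_mul {s : Sig n m} {p : MvPolynomial (Fin n) K} (h : Labels ord F s p)
    {c : K} (hc : c ≠ 0) : Labels ord F s (C c * p) := by
  have := h.monomial_mul 0 hc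
  simpa [Sig.mul] using this

theorem Labels.monic {s : Sig n m} {p : MvPolynomial (Fin n) K} (h : Labels ord F s p) :
    Labels ord F s (monic ord p) := by
  by_cases hp : p = 0
  · rwa [F5.monic, hp, mul_zero, ← hp]
  · exact h.C_mul (inv_ne_zero (ord.leadingCoeff_ne_zero_iff.2 hp))

theorem HasSig.sub {g h : Fin m → MvPolynomial (Fin n) K} {s : Sig n m} (hg : HasSig ord g s)
    (h0 : ∀ j, s.2 < j → h j = 0)
    (hlt : h s.2 = 0 ∨ ord.toSyn (ord.degree (h s.2)) < ord.toSyn s.1) :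
    HasSig ord (g - h) s := by
  obtain ⟨h1, h2, h3⟩ := hg
  rcases hlt with hlt | hlt
  · exact ⟨by simpa [hlt] using h1, by simpa [hlt] using h2, fun j hj => by simp [h3 j hj, h0 j hj]⟩
  · rw [← h2] at hlt
    refine ⟨fun hz => ?_, ?_, fun j hj => by simp [h3 j hj, h0 j hj]⟩
    · rw [Pi.sub_apply, sub_eq_zero] at hz
      rw [hz] at hlt
      exact lt_irrefl _ hlt
    · rw [Pi.sub_apply, ord.degree_sub_of_lt hlt, h2]

theorem Labels.sub_of_lt {s t : Sig n m} {p q : MvPolynomial (Fin n) K}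
    (hp : Labels ord F s p) (hq : Labels ord F t q) (hlt : Sig.Lt ord t s) :
    Labels ord F s (p - q) := by
  obtain ⟨g, hg, rfl⟩ := hp
  obtain ⟨h, ⟨h1, h2, h3⟩, rfl⟩ := hq
  refine ⟨g - h, hg.sub (fun j hj => h3 j (hlt.index_le.trans_lt hj)) ?_, by
    simp [sub_mul]⟩
  rcases hlt with hlt | ⟨heq, hlt⟩
  · exact .inl (h3 _ hlt)
  · exact .inr (by rw [← heq, h2]; exact hlt)

theorem Labels.neg {s : Sig n m} {p : MvPolynomial (Fin n) K}
    (hp : Labels ord F s p) : Labels ord F s (-p) := by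
  simpa using hp.C_mul (c := -1) (by simp)

/-- The correction can be written with components of index below `s.2` only, so the leading term of
the vector is untouched. This is why normal forms modulo the previous basis are harmless. -/
theorem Labels.sub_of_mem {s : Sig n m} {p q : MvPolynomial (Fin n) K}
    (hp : Labels ord F s p) (hq : q ∈ partialIdeal F s.2) : Labels ord F s (p - q) := by
  obtain ⟨g, hg, rfl⟩ := hp
  obtain ⟨h, hh, rfl⟩ := F5.mem_partialIdeal.1 hq
  exact ⟨g - h, hg.sub (fun j hj => hh j (Fin.lt_def.1 hj).le) (.inl (hh _ le_rfl)), by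
    simp [sub_mul]⟩

/-- Two polynomials with the same label differ, up to a scalar, by one with a smaller label. -/
theorem Labels.exists_sub {s : Sig n m} {p q : MvPolynomial (Fin n) K}
    (hp : Labels ord F s p) (hq : Labels ord F s q) :
    ∃ c : K, c ≠ 0 ∧ (p - C c * q ≠ 0 →
      ∃ t, Sig.Lt ord t s ∧ Labels ord F t (p - C c * q)) := by
  obtain ⟨g, ⟨g1, g2, g3⟩, rfl⟩ := hp
  obtain ⟨h, ⟨h1, h2, h3⟩, rfl⟩ := hq
  have hg0 := ord.leadingCoeff_ne_zero_iff.2 g1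
  have hh0 := ord.leadingCoeff_ne_zero_iff.2 h1
  -- The ratio of the head coefficients: the head terms of the two components at index `s.2` cancel.
  set c := ord.leadingCoeff (g s.2) * (ord.leadingCoeff (h s.2))⁻¹ with hc
  have hc0 : c ≠ 0 := mul_ne_zero hg0 (inv_ne_zero hh0)
  refine ⟨c, hc0, fun hne => ?_⟩
  set d : Fin m → MvPolynomial (Fin n) K := fun j => g j - C c * h j with hd
  have hsum : ∑ j, d j * F j = ∑ j, g j * F j - C c * ∑ j, h j * F j := by
    simp [hd, sub_mul, Finset.mul_sum, mul_assoc]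
  have hd0 : d ≠ 0 := by
    intro h0
    rw [← hsum, h0] at hne
    simp at hne
  obtain ⟨t, ht⟩ := exists_hasSig (ord := ord) hd0
  refine ⟨t, ?_, d, ht, hsum⟩
  have hle : t.2 ≤ s.2 := by
    by_contra hlt
    rw [not_le] at hlt
    exact ht.1 (by simp [hd, g3 _ hlt, h3 _ hlt])
  rcases hle.lt_or_eq with hlt | heq
  · exact .inl hlt
  · refine .inr ⟨heq, ?_⟩
    have hdeg : ord.degree (C c * h s.2) = s.1 := by
      have := degree_monomial_mul (ord := ord) 0 hc0 h1
      rw [zero_add, h2] at this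
      exact this
    have hle : ord.toSyn (ord.degree (d s.2)) ≤ ord.toSyn s.1 := by
      have := ord.degree_sub_le (f := g s.2) (g := C c * h s.2)
      rwa [g2, hdeg, sup_idem] at this
    have hcoeff : (d s.2).coeff s.1 = 0 := by
      have e1 : (g s.2).coeff s.1 = ord.leadingCoeff (g s.2) := by
        rw [← g2, MonomialOrder.leadingCoeff]
      have e2 : (h s.2).coeff s.1 = ord.leadingCoeff (h s.2) := by
        rw [← h2, MonomialOrder.leadingCoeff]
      simp only [hd, coeff_sub, coeff_C_mul, e1, e2, hc]
      field_simp
      ring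
    rw [← ht.2.1, heq]
    refine lt_of_le_of_ne hle fun he => ?_
    have he := ord.toSyn.injective he
    rw [← he] at hcoeff
    have h0 := ht.1
    rw [heq] at h0
    exact ord.coeff_degree_ne_zero_iff.2 h0 hcoeff

/-- The signatures of principal syzygies. -/
theorem labels_zero_of_mem {i : Fin m} {p : MvPolynomial (Fin n) K} (hp : p ∈ partialIdeal F i)
    (h0 : p ≠ 0) : Labels ord F (ord.degree p, i) 0 := by
  classical
  obtain ⟨h, hh, rfl⟩ := mem_partialIdeal.1 hp
  set p := ∑ j, h j * F j with hp
  have hL : Labels ord F (ord.degree p, i) (p * F i) := by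
    refine ⟨Pi.single i p, ⟨by simpa using h0, by simp, fun j hj => ?_⟩, ?_⟩
    · exact Pi.single_eq_of_ne (ne_of_gt hj) _
    · rw [Finset.sum_eq_single i] <;> simp +contextual
  -- The product is also a combination of the preceding generators; subtracting this second
  -- representation gives a syzygy whose leading component is still `p`.
  have hmem : p * F i ∈ partialIdeal F i :=
    Ideal.mul_mem_right _ _ (mem_partialIdeal.2 ⟨h, hh, rfl⟩)
  simpa using hL.sub_of_mem hmem

theorem labels_zero_of_le {i : Fin m} {p : MvPolynomial (Fin n) K} (hp : p ∈ partialIdeal F i)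
    (h0 : p ≠ 0) {t : Mon n} (ht : ord.degree p ≤ t) : Labels ord F (t, i) 0 := by
  have := (labels_zero_of_mem (ord := ord) hp h0).monomial_mul (t - ord.degree p) (c := (1 : K))
    one_ne_zero
  rwa [mul_zero, Sig.mul, tsub_add_cancel_of_le ht] at this

theorem labels_generator (i : Fin m) : Labels ord F (0, i) (F i) := by
  classical
  refine ⟨Pi.single i 1, ⟨by simp, by simp, fun j hj => Pi.single_eq_of_ne (ne_of_gt hj) _⟩, ?_⟩
  rw [Finset.sum_eq_single i] <;> simp +contextual

end Labels

end F5

namespace F5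

/-! ### Rewrite rules and the rewriting relation -/

section Rules

variable {K : Type*} [Field K] {n m : ℕ} {M : Memory K n m}

/-- The rules are listed by increasing position, each is the label of its position, and every
position has a rule of its own unless it is the first one of its index. -/
structure Memory.RulesValid (M : Memory K n m) : Prop where
  sorted : ∀ ν, (M.rules ν).Pairwise fun ρ ρ' => ρ.2 < ρ'.2
  sig_eq : ∀ ν, ∀ ρ ∈ M.rules ν, ρ.2 < M.size ∧ M.sig ρ.2 = (ρ.1, ν)
  self_or : ∀ k < M.size, ((M.sig k).1, k) ∈ M.rules (M.sig k).2 ∨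
    ∀ j < M.size, (M.sig j).2 = (M.sig k).2 → k ≤ j

/-- Some rule that was added after `k` applies to the multiple `(u, k)`. -/
def Memory.Rewritten (M : Memory K n m) (u : Mon n) (k : ℕ) : Prop :=
  ∃ ρ ∈ M.rules (M.sig k).2, ρ.1 ≤ u + (M.sig k).1 ∧ k < ρ.2

theorem Memory.Rewritten.mono {u v : Mon n} {k : ℕ} (h : M.Rewritten u k) (huv : u ≤ v) :
    M.Rewritten v k := by
  obtain ⟨ρ, h1, h2, h3⟩ := h
  exact ⟨ρ, h1, h2.trans (add_le_add_left huv _), h3⟩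

theorem le_of_find?_reverse_eq_some {α : Type*} {l : List (α × ℕ)} {p : α × ℕ → Bool}
    (hl : l.Pairwise fun ρ ρ' => ρ.2 < ρ'.2) {ρ σ : α × ℕ}
    (hρ : l.reverse.find? p = some ρ) (hσ : σ ∈ l) (hp : p σ = true) : σ.2 ≤ ρ.2 := by
  obtain ⟨_, as, bs, heq, has⟩ := List.find?_eq_some_iff_append.1 hρ
  have hmem : σ ∈ l.reverse := List.mem_reverse.2 hσ
  have hpw := List.pairwise_reverse.2 hl
  rw [heq] at hmem hpw
  rcases List.mem_append.1 hmem with h | h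
  · have := has σ h
    simp [hp] at this
  · rcases List.mem_cons.1 h with h | h
    · exact h ▸ le_rfl
    · exact ((List.pairwise_cons.1 (List.pairwise_append.1 hpw).2.1).1 σ h).le

/-- Rules are sorted by position, so the search finds the latest applicable one. The rule of `k`
itself always applies, so the result differs from `k` only if it is later. A position without a rule
is the first of its index, and all rules of that index belong to positions no earlier. -/
theorem Memory.RulesValid.isRewritable_iff (h : M.RulesValid) {u : Mon n} {k : ℕ}
    (hk : k < M.size) : M.IsRewritable u k ↔ M.Rewritten u k := by
  classical
  unfold Memory.IsRewritable Memory.findRewriting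
  constructor
  · intro hr
    split at hr
    · rename_i ρ hρ
      have hmem : ρ ∈ M.rules (M.sig k).2 := List.mem_reverse.1 (List.mem_of_find?_eq_some hρ)
      have hle : ρ.1 ≤ u + (M.sig k).1 := by simpa using List.find?_some hρ
      refine ⟨ρ, hmem, hle, lt_of_le_of_ne ?_ (Ne.symm hr)⟩
      rcases h.self_or k hk with hs | hs
      · exact le_of_find?_reverse_eq_some (h.sorted _) hρ hs (by simp)
      · obtain ⟨hlt, hsig⟩ := h.sig_eq _ _ hmem
        exact hs _ hlt (by rw [hsig])
    · exact absurd rfl hr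
  · rintro ⟨σ, hσ, hle, hlt⟩
    split
    · rename_i ρ hρ
      exact (hlt.trans_le (le_of_find?_reverse_eq_some (h.sorted _) hρ hσ (by simpa using hle))).ne'
    · rename_i hn
      have := List.find?_eq_none.1 hn σ (List.mem_reverse.2 hσ)
      simp [hle] at this

/-- If the signatures agreed, the rule of the later position would rewrite the multiple of the
earlier one. The later position has a rule, not being the first of its index. -/
theorem Memory.RulesValid.sig_mul_ne (h : M.RulesValid) {u v : Mon n} {k l : ℕ} (hkl : k ≠ l)
    (hk : k < M.size) (hl : l < M.size) (huk : ¬ M.Rewritten u k) (hvl : ¬ M.Rewritten v l) :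
    Sig.mul u (M.sig k) ≠ Sig.mul v (M.sig l) := by
  wlog hlt : k < l generalizing k l u v
  · exact (this hkl.symm hl hk hvl huk (lt_of_le_of_ne (not_lt.1 hlt) hkl.symm)).symm
  intro heq
  have h1 : u + (M.sig k).1 = v + (M.sig l).1 := congrArg Prod.fst heq
  have h2 : (M.sig k).2 = (M.sig l).2 := (Prod.ext_iff.1 heq).2
  rcases h.self_or l hl with hs | hs
  · exact huk ⟨_, h2 ▸ hs, h1 ▸ le_add_self, hlt⟩
  · exact absurd (hs k hk h2) (not_le.2 hlt)

/-- The canonical multiple of signature `s`: it belongs to the latest rule whose monomial divides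
that of `s`, or to the generator `c` if no rule applies. -/
theorem Memory.RulesValid.exists_not_rewritten (h : M.RulesValid) (s : Sig n m) {c : ℕ}
    (hc : M.sig c = (0, s.2)) :
    ∃ k u, (k = c ∨ ∃ ρ ∈ M.rules s.2, ρ.2 = k) ∧ Sig.mul u (M.sig k) = s ∧
      ¬ M.Rewritten u k := by
  classical
  let S := (M.rules s.2).toFinset.filter fun ρ => ρ.1 ≤ s.1
  by_cases hS : S.Nonempty
  · obtain ⟨ρ, hρ, hmax⟩ := S.exists_max_image (fun ρ => ρ.2) hS
    have hρ' : ρ ∈ M.rules s.2 ∧ ρ.1 ≤ s.1 := by simpa [S] using hρ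
    have hsig := (h.sig_eq _ _ hρ'.1).2
    refine ⟨ρ.2, s.1 - ρ.1, .inr ⟨ρ, hρ'.1, rfl⟩, ?_, ?_⟩
    · rw [hsig, Sig.mul, tsub_add_cancel_of_le hρ'.2]
    · rintro ⟨σ, hσ, hle, hlt⟩
      rw [hsig] at hσ hle
      rw [tsub_add_cancel_of_le hρ'.2] at hle
      exact absurd (hmax σ (by simpa [S] using ⟨hσ, hle⟩)) (not_le.2 hlt)
  · refine ⟨c, s.1, .inl rfl, by rw [hc, Sig.mul, add_zero], ?_⟩
    rintro ⟨σ, hσ, hle, _⟩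
    rw [hc] at hσ hle
    rw [add_zero] at hle
    exact hS ⟨σ, by simpa [S] using ⟨hσ, hle⟩⟩

end Rules

/-! ### Covering of head monomials by unrewritten multiples -/

section Cover

variable {K : Type*} [Field K] {n m : ℕ} {ord : MonomialOrder (Fin n)}
  {F : Fin m → MvPolynomial (Fin n) K} {M : Memory K n m}

/-- If `τ` is the least label of a polynomial with a given head monomial, then that head monomial
is attained by a multiple of label `τ`, not subject to rewriting, of an element of `G`. -/
def MinCover (ord : MonomialOrder (Fin n)) (F : Fin m → MvPolynomial (Fin n) K)
    (M : Memory K n m) (G : Finset ℕ) (τ : Sig n m) : Prop :=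
  ∀ p, Labels ord F τ p → p ≠ 0 →
    (∀ t, Sig.Lt ord t τ → ∀ q, Labels ord F t q → q ≠ 0 → ord.degree q ≠ ord.degree p) →
    ∃ k ∈ G, ∃ u, Sig.mul u (M.sig k) = τ ∧ ¬ M.Rewritten u k ∧
      u + ord.degree (M.poly k) = ord.degree p

/-- Pass to the least label `τ` of any polynomial with the head monomial of `p`. Zero cannot have
label `τ`, since comparison with it would give a witness of `τ` a smaller label. -/
theorem exists_cover {G : Finset ℕ} {s : Sig n m}
    (h : ∀ t, ¬ Sig.Lt ord s t → MinCover ord F M G t) {p : MvPolynomial (Fin n) K}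
    (hp : Labels ord F s p) (h0 : p ≠ 0) :
    ∃ τ, ¬ Sig.Lt ord s τ ∧ ¬ Labels ord F τ 0 ∧ ∃ k ∈ G, ∃ u, Sig.mul u (M.sig k) = τ ∧
      ¬ M.Rewritten u k ∧ u + ord.degree (M.poly k) = ord.degree p := by
  obtain ⟨τ, ⟨q, hq, hq0, hqp⟩, hmin⟩ := (Sig.lt_wellFounded ord).has_min
    {t : Sig n m | ∃ q, Labels ord F t q ∧ q ≠ 0 ∧ ord.degree q = ord.degree p} ⟨s, p, hp, h0, rfl⟩
  have hτ := hmin s ⟨p, hp, h0, rfl⟩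
  refine ⟨τ, hτ, fun hz => ?_, ?_⟩
  · obtain ⟨c, _, hc⟩ := hq.exists_sub hz
    rw [mul_zero, sub_zero] at hc
    obtain ⟨t, ht, htq⟩ := hc hq0
    exact hmin t ⟨q, htq, hq0, hqp⟩ ht
  · rw [← hqp]
    exact h τ hτ q hq hq0 fun t ht r hr hr0 hrq => hmin t ⟨r, hr, hr0, hrq.trans hqp⟩ ht

/-- The critical pair of `k` and `l` needs no consideration. -/
def Memory.Resolved (M : Memory K n m) (ord : MonomialOrder (Fin n)) (i : Fin m)
    (prev : Finset ℕ) (k l : ℕ) : Prop :=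
  ((M.sig k).2 = i ∧ M.TopReducible ord prev
    (ord.degree (M.poly k) ⊔ ord.degree (M.poly l) - ord.degree (M.poly k) + (M.sig k).1)) ∨
  ((M.sig l).2 = i ∧ M.TopReducible ord prev
    (ord.degree (M.poly k) ⊔ ord.degree (M.poly l) - ord.degree (M.poly l) + (M.sig l).1)) ∨
  M.Rewritten (ord.degree (M.poly k) ⊔ ord.degree (M.poly l) - ord.degree (M.poly k)) k ∨
  M.Rewritten (ord.degree (M.poly k) ⊔ ord.degree (M.poly l) - ord.degree (M.poly l)) l

theorem Memory.TopReducible.mono {prev : Finset ℕ} {s t : Mon n}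
    (h : M.TopReducible ord prev s) (hst : s ≤ t) : M.TopReducible ord prev t := by
  obtain ⟨l, hl, hle⟩ := h
  exact ⟨l, hl, hle.trans hst⟩

theorem sup_tsub_le {a b u v : Mon n} (h : u + a = v + b) : a ⊔ b - a ≤ u := by
  rw [tsub_le_iff_right]
  exact sup_le le_add_self (h ▸ le_add_self)

/-- If all critical pairs of index `i` are resolved, then the covering property extends from the
indices below `i` to the index `i`. -/
theorem minCover_of_resolved {i : Fin m} {prev cur : Finset ℕ}
    (htr : ∀ t, M.TopReducible ord prev t → Labels ord F (t, i) 0)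
    (hcanon : ∀ s : Sig n m, s.2 = i → ∃ k u, Sig.mul u (M.sig k) = s ∧ ¬ M.Rewritten u k ∧
      Labels ord F (M.sig k) (M.poly k) ∧ (k ∈ cur ∨ M.poly k = 0))
    (hres : ∀ k ∈ cur, ∀ l ∈ cur, k ≠ l → (M.sig k).2 = i → M.Resolved ord i prev k l)
    (hlow : ∀ s : Sig n m, s.2 < i → MinCover ord F M cur s) :
    ∀ s : Sig n m, s.2 ≤ i → MinCover ord F M cur s := by
  intro s
  induction s using (Sig.lt_wellFounded ord).induction with
  | _ s ih =>
  intro hsi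
  rcases hsi.lt_or_eq with hsi | hsi
  · exact hlow s hsi
  intro p hp hp0 hmin
  -- Compared with zero under the same label, `p` itself would get a smaller label, against
  -- minimality.
  have hz : ¬ Labels ord F s 0 := by
    intro hz
    obtain ⟨c, _, hc⟩ := hp.exists_sub hz
    rw [mul_zero, sub_zero] at hc
    obtain ⟨t, ht, htp⟩ := hc hp0
    exact hmin t ht p htp hp0 rfl
  have hstr : ¬ M.TopReducible ord prev s.1 := fun h => hz (by simpa [← hsi] using htr _ h)
  obtain ⟨k, u, hu, hrw, hlab, hk⟩ := hcanon s hsi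
  have hlab' := hlab.monomial_mul u (c := (1 : K)) one_ne_zero
  rw [hu] at hlab'
  have hk0 : M.poly k ≠ 0 := by
    intro h0
    rw [h0, mul_zero] at hlab'
    exact hz hlab'
  replace hk := hk.resolve_right hk0
  have hdeg := degree_monomial_mul (ord := ord) u (one_ne_zero (α := K)) hk0
  set q := monomial u (1 : K) * M.poly k with hq
  by_cases heq : u + ord.degree (M.poly k) = ord.degree p
  · exact ⟨k, hk, u, hu, hrw, heq⟩
  exfalso
  obtain ⟨c, hc0, hc⟩ := hp.exists_sub hlab'
  have hq0 : q ≠ 0 := mul_ne_zero (by simp) hk0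
  have hcq : ord.degree (C c * q) = u + ord.degree (M.poly k) := by
    have := degree_monomial_mul (ord := ord) 0 hc0 hq0
    rw [zero_add, hdeg] at this
    exact this
  have hr0 : p - C c * q ≠ 0 := by
    intro h0
    rw [sub_eq_zero] at h0
    rw [← hcq, ← h0] at heq
    exact heq rfl
  obtain ⟨t, hts, htr'⟩ := hc hr0
  -- If the head monomial of `q` is smaller than that of `p`, the difference keeps the latter with a
  -- smaller label, against minimality. So that of `q` is larger and survives in the difference.
  rcases lt_or_gt_of_ne (fun h => heq (ord.toSyn.injective h)) with hlt | hgt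
  · refine hmin t hts _ htr' hr0 (ord.degree_sub_of_lt ?_)
    rwa [hcq]
  have hrdeg : ord.degree (p - C c * q) = u + ord.degree (M.poly k) := by
    rw [← neg_sub, ord.degree_neg, ord.degree_sub_of_lt (by rwa [hcq]), hcq]
  have hlt_of : ∀ t', ¬ Sig.Lt ord t t' → Sig.Lt ord t' s := by
    intro t' ht'
    rcases Sig.lt_or_eq_or_gt ord t' t with h | h | h
    · exact h.trans hts
    · exact h ▸ hts
    · exact absurd h ht'
  -- By induction the head monomial of `q` is also attained by an unrewritten multiple of signature
  -- below `s`.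
  obtain ⟨τ, hτ, hτz, k', hk', u', hu', hrw', hdeg'⟩ := exists_cover (M := M) (G := cur)
    (fun t' ht' => ih t' (hlt_of t' ht') ((hlt_of t' ht').index_le.trans hsi.le)) htr' hr0
  have hτs := hlt_of τ hτ
  rw [hrdeg] at hdeg'
  have hne : k ≠ k' := by
    rintro rfl
    have : u' = u := add_right_cancel hdeg'
    rw [← hu', ← hu, this] at hτs
    exact Sig.Lt.irrefl _ hτs
  have hle := sup_tsub_le hdeg'.symm
  have hle' := sup_tsub_le hdeg'
  rw [sup_comm] at hle'
  have hki : (M.sig k).2 = i := by rw [← hsi, ← hu]; rfl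
  -- The two multiples share their head monomial, so `u` and `u'` are divisible by the cofactors of
  -- the critical pair; each reason for its being resolved therefore carries over to them.
  rcases hres k hk k' hk' hne hki with ⟨_, h⟩ | ⟨hi, h⟩ | h | h
  · refine hstr (h.mono ?_)
    rw [← hu]
    exact add_le_add_left hle _
  · refine hτz ?_
    have := htr _ (h.mono (add_le_add_left hle' _))
    rw [← hu', Sig.mul, hi]
    exact this
  · exact hrw (h.mono hle)
  · exact hrw' (h.mono hle')

end Cover

end F5

namespace F5

/-! ### Effect of memory operations on rules, rewriting and covering -/

section Memory

variable {K : Type*} [Field K] {n m : ℕ} {M : Memory K n m}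

@[simp] theorem Memory.sig_setPoly (k j : ℕ) (p : MvPolynomial (Fin n) K) :
    (M.setPoly k p).sig j = M.sig j := by
  by_cases h : j = k
  · subst h; simp [Memory.setPoly, Memory.sig]
  · simp [Memory.setPoly, Memory.sig, h]

@[simp] theorem Memory.poly_setPoly_self (k : ℕ) (p : MvPolynomial (Fin n) K) :
    (M.setPoly k p).poly k = p := by
  simp [Memory.setPoly, Memory.poly]

theorem Memory.poly_setPoly_of_ne {k j : ℕ} (h : j ≠ k) (p : MvPolynomial (Fin n) K) :
    (M.setPoly k p).poly j = M.poly j := by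
  simp [Memory.setPoly, Memory.poly, h]

@[simp] theorem Memory.size_setPoly (k : ℕ) (p : MvPolynomial (Fin n) K) :
    (M.setPoly k p).size = M.size := rfl

@[simp] theorem Memory.rules_setPoly (k : ℕ) (p : MvPolynomial (Fin n) K) :
    (M.setPoly k p).rules = M.rules := rfl

@[simp] theorem Memory.sig_append_size (s : Sig n m) (p : MvPolynomial (Fin n) K) :
    (M.append s p).sig M.size = s := by
  simp [Memory.append, Memory.sig]

@[simp] theorem Memory.poly_append_size (s : Sig n m) (p : MvPolynomial (Fin n) K) :
    (M.append s p).poly M.size = p := by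
  simp [Memory.append, Memory.poly]

theorem Memory.sig_append_of_lt {k : ℕ} (h : k < M.size) (s : Sig n m)
    (p : MvPolynomial (Fin n) K) : (M.append s p).sig k = M.sig k := by
  simp [Memory.append, Memory.sig, h.ne]

theorem Memory.poly_append_of_lt {k : ℕ} (h : k < M.size) (s : Sig n m)
    (p : MvPolynomial (Fin n) K) : (M.append s p).poly k = M.poly k := by
  simp [Memory.append, Memory.poly, h.ne]

@[simp] theorem Memory.sig_appendWithRule (k : ℕ) (s : Sig n m) (p : MvPolynomial (Fin n) K) :
    (M.appendWithRule s p).sig k = (M.append s p).sig k := rfl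

@[simp] theorem Memory.poly_appendWithRule (k : ℕ) (s : Sig n m) (p : MvPolynomial (Fin n) K) :
    (M.appendWithRule s p).poly k = (M.append s p).poly k := rfl

@[simp] theorem Memory.size_appendWithRule (s : Sig n m) (p : MvPolynomial (Fin n) K) :
    (M.appendWithRule s p).size = M.size + 1 := rfl

theorem Memory.rules_appendWithRule_self (s : Sig n m) (p : MvPolynomial (Fin n) K) :
    (M.appendWithRule s p).rules s.2 = M.rules s.2 ++ [(s.1, M.size)] := by
  simp [Memory.appendWithRule, Memory.addRule, Memory.append]

theorem Memory.rules_appendWithRule_of_ne {ν : Fin m} {s : Sig n m} (h : ν ≠ s.2)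
    (p : MvPolynomial (Fin n) K) : (M.appendWithRule s p).rules ν = M.rules ν := by
  simp [Memory.appendWithRule, Memory.addRule, Memory.append, h]

theorem Memory.mem_rules_appendWithRule {ν : Fin m} {s : Sig n m} {p : MvPolynomial (Fin n) K}
    {ρ : Mon n × ℕ} : ρ ∈ (M.appendWithRule s p).rules ν ↔
      ρ ∈ M.rules ν ∨ (ν = s.2 ∧ ρ = (s.1, M.size)) := by
  by_cases h : ν = s.2
  · subst h
    simp [Memory.rules_appendWithRule_self]
  · simp [Memory.rules_appendWithRule_of_ne h, h]

theorem Memory.RulesValid.setPoly (h : M.RulesValid) (k : ℕ) (p : MvPolynomial (Fin n) K) :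
    (M.setPoly k p).RulesValid where
  sorted := h.sorted
  sig_eq := by simpa using h.sig_eq
  self_or := by simpa using h.self_or

theorem Memory.RulesValid.appendWithRule (h : M.RulesValid) (s : Sig n m)
    (p : MvPolynomial (Fin n) K) : (M.appendWithRule s p).RulesValid where
  sorted := by
    intro ν
    by_cases hν : ν = s.2
    · subst hν
      rw [Memory.rules_appendWithRule_self]
      refine List.pairwise_append.2 ⟨h.sorted _, by simp, fun ρ hρ σ hσ => ?_⟩
      rw [List.mem_singleton.1 hσ]
      exact (h.sig_eq _ _ hρ).1
    · rw [Memory.rules_appendWithRule_of_ne hν]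
      exact h.sorted ν
  sig_eq := by
    intro ν ρ hρ
    rcases Memory.mem_rules_appendWithRule.1 hρ with hρ | ⟨rfl, rfl⟩
    · obtain ⟨h1, h2⟩ := h.sig_eq ν ρ hρ
      exact ⟨h1.trans (Nat.lt_succ_self _), by
        rw [Memory.sig_appendWithRule, Memory.sig_append_of_lt h1, h2]⟩
    · simp
  self_or := by
    intro k hk
    rcases (Nat.lt_succ_iff.1 hk).lt_or_eq with hk | rfl
    · rw [Memory.sig_appendWithRule, Memory.sig_append_of_lt hk]
      rcases h.self_or k hk with hs | hs
      · exact .inl (Memory.mem_rules_appendWithRule.2 (.inl hs))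
      · refine .inr fun j hj hjk => ?_
        rcases (Nat.lt_succ_iff.1 hj).lt_or_eq with hj | rfl
        · rw [Memory.sig_appendWithRule, Memory.sig_append_of_lt hj] at hjk
          exact hs j hj hjk
        · exact hk.le
    · exact .inl (Memory.mem_rules_appendWithRule.2 (.inr (by simp)))

theorem Memory.RulesValid.append (h : M.RulesValid) {s : Sig n m}
    (hs : ∀ k < M.size, (M.sig k).2 ≠ s.2) (p : MvPolynomial (Fin n) K) :
    (M.append s p).RulesValid where
  sorted := h.sorted
  sig_eq := by
    intro ν ρ hρ
    obtain ⟨h1, h2⟩ := h.sig_eq ν ρ hρ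
    exact ⟨h1.trans (Nat.lt_succ_self _), by rw [Memory.sig_append_of_lt h1, h2]⟩
  self_or := by
    intro k hk
    rcases (Nat.lt_succ_iff.1 hk).lt_or_eq with hk | rfl
    · rw [Memory.sig_append_of_lt hk]
      refine (h.self_or k hk).imp_right fun hs' j hj hjk => ?_
      rcases (Nat.lt_succ_iff.1 hj).lt_or_eq with hj | rfl
      · rw [Memory.sig_append_of_lt hj] at hjk
        exact hs' j hj hjk
      · exact hk.le
    · refine .inr fun j hj hjk => ?_
      rcases (Nat.lt_succ_iff.1 hj).lt_or_eq with hj | rfl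
      · rw [Memory.sig_append_of_lt hj, Memory.sig_append_size] at hjk
        exact absurd hjk (hs j hj)
      · exact le_rfl

/-- `M'` arises from `M` by operations that do not affect the labels, the polynomials at the
positions in `G`, and the rules of indices other than `i`, except that rules are added. -/
structure Memory.Extends (M M' : Memory K n m) (G : Finset ℕ) (i : Fin m) : Prop where
  size_le : M.size ≤ M'.size
  sig_eq : ∀ k < M.size, M'.sig k = M.sig k
  poly_eq : ∀ k ∈ G, M'.poly k = M.poly k
  rules_eq : ∀ ν, ν ≠ i → M'.rules ν = M.rules ν
  rules_subset : ∀ ν, M.rules ν ⊆ M'.rules ν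

theorem Memory.extends_setPoly {k : ℕ} {G : Finset ℕ} (hk : k ∉ G) (i : Fin m)
    (p : MvPolynomial (Fin n) K) : M.Extends (M.setPoly k p) G i where
  size_le := le_rfl
  sig_eq := by simp
  poly_eq := fun j hj => Memory.poly_setPoly_of_ne (ne_of_mem_of_not_mem hj hk) p
  rules_eq := fun _ _ => rfl
  rules_subset := fun _ => List.Subset.refl _

theorem Memory.extends_appendWithRule {G : Finset ℕ} (hG : ∀ k ∈ G, k < M.size) (s : Sig n m)
    (p : MvPolynomial (Fin n) K) : M.Extends (M.appendWithRule s p) G s.2 where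
  size_le := Nat.le_succ _
  sig_eq := fun _ hk => Memory.sig_append_of_lt hk s p
  poly_eq := fun k hk => Memory.poly_append_of_lt (hG k hk) s p
  rules_eq := fun _ hν => Memory.rules_appendWithRule_of_ne hν p
  rules_subset := fun _ _ hρ => Memory.mem_rules_appendWithRule.2 (.inl hρ)

theorem Memory.extends_append {G : Finset ℕ} (hG : ∀ k ∈ G, k < M.size) (s : Sig n m)
    (p : MvPolynomial (Fin n) K) : M.Extends (M.append s p) G s.2 where
  size_le := Nat.le_succ _
  sig_eq := fun _ hk => Memory.sig_append_of_lt hk s p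
  poly_eq := fun k hk => Memory.poly_append_of_lt (hG k hk) s p
  rules_eq := fun _ _ => rfl
  rules_subset := fun _ => List.Subset.refl _

variable {M' : Memory K n m} {G : Finset ℕ} {i : Fin m} {ord : MonomialOrder (Fin n)}
  {F : Fin m → MvPolynomial (Fin n) K}

theorem Memory.Extends.topReducible_iff (h : M.Extends M' G i) {prev : Finset ℕ}
    (hprev : prev ⊆ G) {t : Mon n} :
    M'.TopReducible ord prev t ↔ M.TopReducible ord prev t := by
  unfold Memory.TopReducible
  refine exists_congr fun l => and_congr_right fun hl => ?_
  rw [h.poly_eq l (hprev hl)]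

theorem Memory.Extends.rewritten (h : M.Extends M' G i) {u : Mon n} {k : ℕ} (hk : k < M.size)
    (hr : M.Rewritten u k) : M'.Rewritten u k := by
  obtain ⟨ρ, h1, h2, h3⟩ := hr
  exact ⟨ρ, by rw [h.sig_eq k hk]; exact h.rules_subset _ h1, by rwa [h.sig_eq k hk], h3⟩

theorem Memory.Extends.rewritten_iff (h : M.Extends M' G i) {u : Mon n} {k : ℕ} (hk : k < M.size)
    (hi : (M.sig k).2 ≠ i) : M'.Rewritten u k ↔ M.Rewritten u k := by
  rw [Memory.Rewritten, Memory.Rewritten, h.sig_eq k hk, h.rules_eq _ hi]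

theorem Memory.Extends.resolved (h : M.Extends M' G i) {prev : Finset ℕ} (hprev : prev ⊆ G)
    {k l : ℕ} (hk : k ∈ G) (hl : l ∈ G) (hks : k < M.size) (hls : l < M.size)
    (hr : M.Resolved ord i prev k l) : M'.Resolved ord i prev k l := by
  unfold Memory.Resolved at hr ⊢
  rw [h.poly_eq k hk, h.poly_eq l hl, h.sig_eq k hks, h.sig_eq l hls, h.topReducible_iff hprev,
    h.topReducible_iff hprev]
  exact hr.imp_right (Or.imp_right (Or.imp (h.rewritten hks) (h.rewritten hls)))

/-- New rules could destroy a cover by rewriting its multiples. Here the elements of `prev` have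
index different from `i`, and the rules of their indices are frozen. -/
theorem Memory.Extends.minCover (h : M.Extends M' G i) {prev : Finset ℕ} (hprev : prev ⊆ G)
    (hi : ∀ k ∈ prev, k < M.size ∧ (M.sig k).2 ≠ i) {s : Sig n m}
    (hm : MinCover ord F M prev s) : MinCover ord F M' prev s := by
  intro p hp hp0 hmin
  obtain ⟨k, hk, u, h1, h2, h3⟩ := hm p hp hp0 hmin
  obtain ⟨hks, hki⟩ := hi k hk
  exact ⟨k, hk, u, by rwa [h.sig_eq k hks], by rwa [h.rewritten_iff hks hki], by
    rwa [h.poly_eq k (hprev hk)]⟩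

end Memory

/-! ### Critical pairs and labels of S-polynomials -/

section CriticalPairs

variable {K : Type*} [Field K] {n m : ℕ} {M : Memory K n m} {ord : MonomialOrder (Fin n)}
  {F : Fin m → MvPolynomial (Fin n) K} {i : Fin m} {prev cur : Finset ℕ}

/-- The components of `p` are multiples of the entries at `k` and `l`, in some order. -/
def CritPair.Joins (p : CritPair n) (k l : ℕ) : Prop :=
  (p.k = k ∧ p.l = l) ∨ (p.k = l ∧ p.l = k)

theorem CritPair.Joins.symm {p : CritPair n} {k l : ℕ} (h : p.Joins k l) : p.Joins l k :=
  Or.symm h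

/-- `p` is a critical pair of elements of `cur` that passes the criterion for index `i`. -/
structure CritPair.Valid (p : CritPair n) (ord : MonomialOrder (Fin n)) (M : Memory K n m)
    (i : Fin m) (prev cur : Finset ℕ) : Prop where
  k_mem : p.k ∈ cur
  l_mem : p.l ∈ cur
  ne : p.k ≠ p.l
  u_eq : p.u = ord.degree (M.poly p.k) ⊔ ord.degree (M.poly p.l) - ord.degree (M.poly p.k)
  v_eq : p.v = ord.degree (M.poly p.k) ⊔ ord.degree (M.poly p.l) - ord.degree (M.poly p.l)
  not_lt : ¬ Sig.Lt ord (Sig.mul p.u (M.sig p.k)) (Sig.mul p.v (M.sig p.l))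
  index_eq : (M.sig p.k).2 = i
  not_topReducible : ¬ M.TopReducible ord prev (p.u + (M.sig p.k).1)

theorem Memory.Resolved.symm {k l : ℕ} (h : M.Resolved ord i prev k l) :
    M.Resolved ord i prev l k := by
  unfold Memory.Resolved at h ⊢
  rw [sup_comm]
  tauto

theorem CritPair.Valid.resolved {p : CritPair n} (hp : p.Valid ord M i prev cur)
    (h : M.Rewritten p.u p.k ∨ M.Rewritten p.v p.l) {k l : ℕ} (hj : p.Joins k l) :
    M.Resolved ord i prev k l := by
  have : M.Resolved ord i prev p.k p.l := by
    rw [hp.u_eq, hp.v_eq] at h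
    exact .inr (.inr h)
  rcases hj with ⟨rfl, rfl⟩ | ⟨rfl, rfl⟩
  · exact this
  · exact this.symm

theorem CritPair.Valid.mono {p : CritPair n} (hp : p.Valid ord M i prev cur) {cur' : Finset ℕ}
    (h : cur ⊆ cur') : p.Valid ord M i prev cur' :=
  { hp with k_mem := h hp.k_mem, l_mem := h hp.l_mem }

theorem CritPair.Valid.extends {p : CritPair n} (hp : p.Valid ord M i prev cur)
    {M' : Memory K n m} (h : M.Extends M' cur i) (hcur : ∀ k ∈ cur, k < M.size)
    (hprev : prev ⊆ cur) : p.Valid ord M' i prev cur where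
  k_mem := hp.k_mem
  l_mem := hp.l_mem
  ne := hp.ne
  u_eq := by rw [h.poly_eq _ hp.k_mem, h.poly_eq _ hp.l_mem, hp.u_eq]
  v_eq := by rw [h.poly_eq _ hp.k_mem, h.poly_eq _ hp.l_mem, hp.v_eq]
  not_lt := by
    rw [h.sig_eq _ (hcur _ hp.k_mem), h.sig_eq _ (hcur _ hp.l_mem)]
    exact hp.not_lt
  index_eq := by rw [h.sig_eq _ (hcur _ hp.k_mem), hp.index_eq]
  not_topReducible := by
    rw [h.sig_eq _ (hcur _ hp.k_mem), h.topReducible_iff hprev]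
    exact hp.not_topReducible

theorem resolved_or_exists_critPair (k l : ℕ) :
    M.Resolved ord i prev k l ∨ ∃ p ∈ critPair ord M k l i prev, p.Joins k l := by
  unfold critPair
  dsimp only
  split_ifs with h1 h2 h3
  · exact .inl (.inl h1)
  · exact .inl (.inr (.inl h2))
  · exact .inr ⟨_, Finset.mem_singleton_self _, .inr ⟨rfl, rfl⟩⟩
  · exact .inr ⟨_, Finset.mem_singleton_self _, .inl ⟨rfl, rfl⟩⟩

theorem valid_of_mem_critPair {k l : ℕ} {p : CritPair n} (hp : p ∈ critPair ord M k l i prev)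
    (hk : k ∈ cur) (hl : l ∈ cur) (hkl : k ≠ l) (hki : (M.sig k).2 = i) (hli : (M.sig l).2 ≤ i) :
    p.Valid ord M i prev cur := by
  unfold critPair at hp
  dsimp only at hp
  split_ifs at hp with h1 h2 h3
  · simp at hp
  · simp at hp
  · rw [Finset.mem_singleton] at hp
    subst hp
    -- The components are swapped only if that of `l` has the larger signature, which forces its
    -- index up to `i`.
    have hli' : (M.sig l).2 = i := by
      refine le_antisymm hli ?_
      have := h3.index_le
      rwa [Sig.mul, Sig.mul, hki] at this
    exact
      { k_mem := hl, l_mem := hk, ne := hkl.symm, u_eq := by rw [sup_comm],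
        v_eq := by rw [sup_comm], not_lt := fun h => Sig.Lt.irrefl _ (h.trans h3),
        index_eq := hli', not_topReducible := fun h => h2 ⟨hli', h⟩ }
  · rw [Finset.mem_singleton] at hp
    subst hp
    exact
      { k_mem := hk, l_mem := hl, ne := hkl, u_eq := rfl, v_eq := rfl, not_lt := h3,
        index_eq := hki, not_topReducible := fun h => h1 ⟨hki, h⟩ }

/-- As neither component is rewritten, the two signatures are distinct, so the order of the
components is strict and the leading term cannot cancel. -/
theorem CritPair.Valid.labels_sPolynomial {p : CritPair n} (hp : p.Valid ord M i prev cur)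
    (hM : M.RulesValid) (hcur : ∀ k ∈ cur, k < M.size ∧ M.poly k ≠ 0)
    (hlab : ∀ k < M.size, Labels ord F (M.sig k) (M.poly k))
    (hk : ¬ M.IsRewritable p.u p.k) (hl : ¬ M.IsRewritable p.v p.l) :
    Labels ord F (Sig.mul p.u (M.sig p.k)) (ord.sPolynomial (M.poly p.k) (M.poly p.l)) := by
  obtain ⟨hks, hk0⟩ := hcur _ hp.k_mem
  obtain ⟨hls, hl0⟩ := hcur _ hp.l_mem
  rw [hM.isRewritable_iff hks] at hk
  rw [hM.isRewritable_iff hls] at hl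
  have hne := hM.sig_mul_ne hp.ne hks hls hk hl
  have hlt : Sig.Lt ord (Sig.mul p.v (M.sig p.l)) (Sig.mul p.u (M.sig p.k)) := by
    rcases Sig.lt_or_eq_or_gt ord (Sig.mul p.v (M.sig p.l)) (Sig.mul p.u (M.sig p.k)) with h | h | h
    · exact h
    · exact absurd h.symm hne
    · exact absurd h hp.not_lt
  rw [MonomialOrder.sPolynomial_def, ← hp.u_eq, ← hp.v_eq]
  exact ((hlab _ hks).monomial_mul _ (ord.leadingCoeff_ne_zero_iff.2 hl0)).sub_of_lt
    ((hlab _ hls).monomial_mul _ (ord.leadingCoeff_ne_zero_iff.2 hk0)) hlt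

end CriticalPairs

/-! ### Normal forms and top-reduction preserve labels -/

section Reduction

variable {K : Type*} [Field K] {n m : ℕ} {ord : MonomialOrder (Fin n)}
  {F : Fin m → MvPolynomial (Fin n) K}

theorem monic_ne_zero {p : MvPolynomial (Fin n) K} (hp : p ≠ 0) : monic ord p ≠ 0 :=
  mul_ne_zero (by simpa using hp) hp

theorem degree_monic {p : MvPolynomial (Fin n) K} (hp : p ≠ 0) :
    ord.degree (monic ord p) = ord.degree p := by
  have := degree_monomial_mul (ord := ord) 0 (inv_ne_zero (ord.leadingCoeff_ne_zero_iff.2 hp)) hp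
  rwa [zero_add] at this

theorem IsNormalForm.sub_mem {B : Set (MvPolynomial (Fin n) K)} {p h : MvPolynomial (Fin n) K}
    (hnf : IsNormalForm ord B p h) {I : Ideal (MvPolynomial (Fin n) K)} (hB : B ⊆ I) :
    p - h ∈ I := by
  obtain ⟨hnf, -⟩ := hnf
  induction hnf with
  | refl => simp
  | tail _ hstep ih =>
    obtain ⟨b, hb, _, s, _, _, rfl⟩ := hstep
    rw [← sub_add]
    exact I.add_mem ih (I.mul_mem_left _ (hB hb))

theorem topReduct_eq (p q : MvPolynomial (Fin n) K) : topReduct ord p q =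
    monic ord (p - monomial (ord.degree p - ord.degree q)
      (ord.leadingCoeff p * (ord.leadingCoeff q)⁻¹) * q) := by
  unfold topReduct
  dsimp only
  split_ifs with h
  · rw [h, monic, mul_zero]
  · rfl

theorem Labels.topReduct_of_lt {s t : Sig n m} {p q : MvPolynomial (Fin n) K}
    (hp : Labels ord F s p) (hq : Labels ord F t q) (hp0 : p ≠ 0) (hq0 : q ≠ 0)
    (hlt : Sig.Lt ord (Sig.mul (ord.degree p - ord.degree q) t) s) :
    Labels ord F s (topReduct ord p q) := by
  rw [topReduct_eq]
  refine Labels.monic (hp.sub_of_lt (hq.monomial_mul _ ?_) hlt)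
  exact mul_ne_zero (ord.leadingCoeff_ne_zero_iff.2 hp0)
    (inv_ne_zero (ord.leadingCoeff_ne_zero_iff.2 hq0))

theorem Labels.topReduct_of_gt {s t : Sig n m} {p q : MvPolynomial (Fin n) K}
    (hp : Labels ord F s p) (hq : Labels ord F t q) (hp0 : p ≠ 0) (hq0 : q ≠ 0)
    (hlt : Sig.Lt ord s (Sig.mul (ord.degree p - ord.degree q) t)) :
    Labels ord F (Sig.mul (ord.degree p - ord.degree q) t) (topReduct ord p q) := by
  rw [topReduct_eq, ← neg_sub]
  refine Labels.monic (Labels.neg ((hq.monomial_mul _ ?_).sub_of_lt hp hlt))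
  exact mul_ne_zero (ord.leadingCoeff_ne_zero_iff.2 hp0)
    (inv_ne_zero (ord.leadingCoeff_ne_zero_iff.2 hq0))

end Reduction

end F5

namespace F5

/-! ### Invariants of the main loop and of the computation of a partial basis -/

section Invariant

variable {K : Type*} [Field K] {n m : ℕ} {ord : MonomialOrder (Fin n)}
  {F : Fin m → MvPolynomial (Fin n) K}

/-- The invariant of the main loop. -/
structure BasisInv (ord : MonomialOrder (Fin n)) (F : Fin m → MvPolynomial (Fin n) K)
    (M : Memory K n m) (i : ℕ) (prev : Finset ℕ) (B : Set (MvPolynomial (Fin n) K)) : Prop where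
  rules : M.RulesValid
  labels : ∀ k < M.size, Labels ord F (M.sig k) (M.poly k)
  index_lt : ∀ k < M.size, ((M.sig k).2 : ℕ) < i
  prev_spec : ∀ k ∈ prev, k < M.size ∧ M.poly k ≠ 0
  rule_spec : ∀ ν, ∀ ρ ∈ M.rules ν, ρ.2 ∈ prev ∨ M.poly ρ.2 = 0
  generator : ∀ ν : Fin m, (ν : ℕ) < i → ∃ c ∈ prev, M.sig c = (0, ν)
  cover : ∀ s : Sig n m, (s.2 : ℕ) < i → MinCover ord F M prev s
  groebner : IsGroebnerBasis ord B (partialIdeal F i)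

/-- The invariant of a run of `Partial_Basis` in which the critical pairs in `pend` remain to be
considered and the positions in `act` may still enter the basis. -/
structure StageInv (ord : MonomialOrder (Fin n)) (F : Fin m → MvPolynomial (Fin n) K)
    (M : Memory K n m) (f : Frame K n m) (pend : Set (CritPair n)) (act : Finset ℕ) : Prop where
  rules : M.RulesValid
  labels : ∀ k < M.size, Labels ord F (M.sig k) (M.poly k)
  index_le : ∀ k < M.size, (M.sig k).2 ≤ f.i
  subset_ideal : f.B ⊆ partialIdeal F f.i
  prev_subset : f.prev ⊆ f.cur
  prev_index : ∀ k ∈ f.prev, (M.sig k).2 < f.i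
  cur_spec : ∀ k ∈ f.cur, k < M.size ∧ M.poly k ≠ 0
  act_spec : ∀ k ∈ act, k < M.size ∧ k ∉ f.cur ∧ (M.sig k).2 = f.i ∧
    ¬ M.TopReducible ord f.prev (M.sig k).1
  rule_spec : ∀ ν, ∀ ρ ∈ M.rules ν, ρ.2 ∈ f.cur ∨ ρ.2 ∈ act ∨ M.poly ρ.2 = 0
  generator : ∀ ν ≤ f.i, ∃ c ∈ f.cur, M.sig c = (0, ν)
  resolved : ∀ k ∈ f.cur, ∀ l ∈ f.cur, k ≠ l → (M.sig k).2 = f.i →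
    M.Resolved ord f.i f.prev k l ∨ ∃ p ∈ pend, p.Joins k l
  pend_valid : ∀ p ∈ pend, p.Valid ord M f.i f.prev f.cur
  cover : ∀ s : Sig n m, s.2 < f.i → MinCover ord F M f.prev s

variable {M : Memory K n m} {f : Frame K n m} {pend : Set (CritPair n)} {act : Finset ℕ}

/-- Everything about the current generators and the pending pairs persists; only the clauses on
rules, labels and active positions have to be checked for a particular operation. -/
theorem StageInv.of_extends (h : StageInv ord F M f pend act) {M' : Memory K n m}
    {act' : Finset ℕ} (hext : M.Extends M' f.cur f.i) (rules : M'.RulesValid)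
    (labels : ∀ k < M'.size, Labels ord F (M'.sig k) (M'.poly k))
    (index_le : ∀ k < M'.size, (M'.sig k).2 ≤ f.i)
    (act_spec : ∀ k ∈ act', k < M'.size ∧ k ∉ f.cur ∧ (M'.sig k).2 = f.i ∧
      ¬ M.TopReducible ord f.prev (M'.sig k).1)
    (rule_spec : ∀ ν, ∀ ρ ∈ M'.rules ν, ρ.2 ∈ f.cur ∨ ρ.2 ∈ act' ∨ M'.poly ρ.2 = 0) :
    StageInv ord F M' f pend act' where
  rules := rules
  labels := labels
  index_le := index_le
  subset_ideal := h.subset_ideal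
  prev_subset := h.prev_subset
  prev_index := fun k hk => by
    rw [hext.sig_eq k (h.cur_spec k (h.prev_subset hk)).1]
    exact h.prev_index k hk
  cur_spec := fun k hk => by
    rw [hext.poly_eq k hk]
    exact ⟨(h.cur_spec k hk).1.trans_le hext.size_le, (h.cur_spec k hk).2⟩
  act_spec := fun k hk => by
    rw [hext.topReducible_iff h.prev_subset]
    exact act_spec k hk
  rule_spec := rule_spec
  generator := fun ν hν => by
    obtain ⟨c, hc, hs⟩ := h.generator ν hν
    exact ⟨c, hc, by rw [hext.sig_eq c (h.cur_spec c hc).1, hs]⟩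
  resolved := fun k hk l hl hkl hki => by
    rw [hext.sig_eq k (h.cur_spec k hk).1] at hki
    exact (h.resolved k hk l hl hkl hki).imp_left
      (hext.resolved h.prev_subset hk hl (h.cur_spec k hk).1 (h.cur_spec l hl).1)
  pend_valid := fun p hp =>
    (h.pend_valid p hp).extends hext (fun k hk => (h.cur_spec k hk).1) h.prev_subset
  cover := fun s hs => hext.minCover h.prev_subset
    (fun k hk => ⟨(h.cur_spec k (h.prev_subset hk)).1, (h.prev_index k hk).ne⟩) (h.cover s hs)

theorem StageInv.setPoly (h : StageInv ord F M f pend act) {k : ℕ} (hk : k ∈ act)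
    {p : MvPolynomial (Fin n) K} (hp : Labels ord F (M.sig k) p) :
    StageInv ord F (M.setPoly k p) f pend act := by
  refine h.of_extends (Memory.extends_setPoly (h.act_spec k hk).2.1 f.i p) (h.rules.setPoly k p)
    (fun j hj => ?_) (by simpa using h.index_le) (by simpa using h.act_spec) (fun ν ρ hρ => ?_)
  · rw [Memory.sig_setPoly]
    by_cases hjk : j = k
    · subst hjk
      rwa [Memory.poly_setPoly_self]
    · rw [Memory.poly_setPoly_of_ne hjk]
      exact h.labels j hj
  · by_cases hρk : ρ.2 = k
    · exact .inr (.inl (hρk ▸ hk))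
    · rw [Memory.poly_setPoly_of_ne hρk]
      exact h.rule_spec ν ρ hρ

theorem StageInv.appendWithRule (h : StageInv ord F M f pend act) {s : Sig n m}
    (hs : s.2 = f.i) (htr : ¬ M.TopReducible ord f.prev s.1)
    {p : MvPolynomial (Fin n) K} (hp : Labels ord F s p) :
    StageInv ord F (M.appendWithRule s p) f pend (insert M.size act) := by
  have hext : M.Extends (M.appendWithRule s p) f.cur f.i :=
    hs ▸ Memory.extends_appendWithRule (fun k hk => (h.cur_spec k hk).1) s p
  refine h.of_extends hext (h.rules.appendWithRule s p)
    (fun k hk => ?_) (fun k hk => ?_) (fun k hk => ?_) (fun ν ρ hρ => ?_)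
  · rcases (Nat.lt_succ_iff.1 hk).lt_or_eq with hk | rfl
    · simpa [Memory.sig_append_of_lt hk, Memory.poly_append_of_lt hk] using h.labels k hk
    · simpa using hp
  · rcases (Nat.lt_succ_iff.1 hk).lt_or_eq with hk | rfl
    · simpa [Memory.sig_append_of_lt hk] using h.index_le k hk
    · simpa using hs.le
  · rcases Finset.mem_insert.1 hk with rfl | hk
    · refine ⟨Nat.lt_succ_self _, fun hc => lt_irrefl _ (h.cur_spec _ hc).1, ?_, ?_⟩
      · simpa using hs
      · simpa using htr
    · obtain ⟨h1, h2, h3, h4⟩ := h.act_spec k hk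
      rw [Memory.sig_appendWithRule, Memory.sig_append_of_lt h1]
      exact ⟨h1.trans (Nat.lt_succ_self _), h2, h3, h4⟩
  · rcases Memory.mem_rules_appendWithRule.1 hρ with hρ | ⟨_, rfl⟩
    · rw [Memory.poly_appendWithRule, Memory.poly_append_of_lt (h.rules.sig_eq ν ρ hρ).1]
      exact (h.rule_spec ν ρ hρ).imp_right (Or.imp_left Finset.mem_insert_of_mem)
    · exact .inr (.inl (Finset.mem_insert_self _ _))

/-- Positions may be dropped if their polynomial is zero: their rules then mark signatures of
syzygies, which are never least labels. -/
theorem StageInv.restrict (h : StageInv ord F M f pend act) {act' : Finset ℕ}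
    (hsub : act' ⊆ act) (hzero : ∀ k ∈ act, k ∉ act' → M.poly k = 0) :
    StageInv ord F M f pend act' :=
  { h with
    act_spec := fun k hk => h.act_spec k (hsub hk)
    rule_spec := fun ν ρ hρ => by
      rcases h.rule_spec ν ρ hρ with h1 | h1 | h1
      · exact .inl h1
      · by_cases h2 : ρ.2 ∈ act'
        · exact .inr (.inl h2)
        · exact .inr (.inr (hzero _ h1 h2))
      · exact .inr (.inr h1) }

theorem StageInv.discharge (h : StageInv ord F M f pend act) {pend' : Set (CritPair n)}
    (hsub : pend' ⊆ pend)
    (hrw : ∀ p ∈ pend, p ∉ pend' → M.Rewritten p.u p.k ∨ M.Rewritten p.v p.l) :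
    StageInv ord F M f pend' act :=
  { h with
    resolved := fun k hk l hl hkl hki => by
      rcases h.resolved k hk l hl hkl hki with h1 | ⟨p, hp, hj⟩
      · exact .inl h1
      · by_cases hp' : p ∈ pend'
        · exact .inr ⟨p, hp', hj⟩
        · exact .inl ((h.pend_valid p hp).resolved (hrw p hp hp') hj)
    pend_valid := fun p hp => h.pend_valid p (hsub hp) }

theorem StageInv.with_pairs (h : StageInv ord F M f pend act) (P : Finset (CritPair n)) :
    StageInv ord F M { f with pairs := P } pend act :=
  { h with }

/-- The pair is settled at once, before any reduction: the new rule has the signature of the larger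
component. -/
theorem StageInv.processPair {p : CritPair n} {pend' : Set (CritPair n)}
    (h : StageInv ord F M f pend act) (hp : p ∈ pend) (hsub : pend' ⊆ pend)
    (hpend : ∀ q ∈ pend, q = p ∨ q ∈ pend') (hk : ¬ M.IsRewritable p.u p.k)
    (hl : ¬ M.IsRewritable p.v p.l) :
    StageInv ord F (M.appendWithRule (Sig.mul p.u (M.sig p.k))
      (ord.sPolynomial (M.poly p.k) (M.poly p.l))) f pend' (insert M.size act) := by
  have hv := h.pend_valid p hp
  have hks := (h.cur_spec _ hv.k_mem).1
  have hlab := hv.labels_sPolynomial h.rules h.cur_spec h.labels hk hl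
  refine (h.appendWithRule (s := Sig.mul p.u (M.sig p.k)) hv.index_eq hv.not_topReducible hlab).discharge hsub
    fun q hq hq' => .inl ?_
  -- The new position `M.size` exceeds `q.k`, so the rule just added rewrites the multiple `(q.u,
  -- q.k)`.
  rcases hpend q hq with rfl | hq''
  · refine ⟨(q.u + (M.sig q.k).1, M.size), ?_, ?_, hks⟩
    · rw [Memory.sig_appendWithRule, Memory.sig_append_of_lt hks]
      exact Memory.mem_rules_appendWithRule.2 (.inr ⟨rfl, rfl⟩)
    · rw [Memory.sig_appendWithRule, Memory.sig_append_of_lt hks]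
  · exact absurd hq'' hq'

theorem StageInv.addCritPairs (h : StageInv ord F M f pend act) {k : ℕ} (hk : k ∈ act)
    (hk0 : M.poly k ≠ 0) (P : Finset (CritPair n)) :
    StageInv ord F M { f with pairs := P, cur := insert k f.cur }
      (pend ∪ {p | ∃ j ∈ f.cur, p ∈ critPair ord M k j f.i f.prev}) (act.erase k) := by
  obtain ⟨hks, hkc, hki, hktr⟩ := h.act_spec k hk
  exact
  { rules := h.rules
    labels := h.labels
    index_le := h.index_le
    subset_ideal := h.subset_ideal
    prev_subset := h.prev_subset.trans (Finset.subset_insert _ _)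
    prev_index := h.prev_index
    cur_spec := fun j hj => by
      rcases Finset.mem_insert.1 hj with rfl | hj
      · exact ⟨hks, hk0⟩
      · exact h.cur_spec j hj
    act_spec := fun j hj => by
      obtain ⟨hjk, hj⟩ := Finset.mem_erase.1 hj
      obtain ⟨h1, h2, h3⟩ := h.act_spec j hj
      exact ⟨h1, by simpa [hjk] using h2, h3⟩
    rule_spec := fun ν ρ hρ => by
      rcases h.rule_spec ν ρ hρ with h1 | h1 | h1
      · exact .inl (Finset.mem_insert_of_mem h1)
      · by_cases hρk : ρ.2 = k
        · exact .inl (hρk ▸ Finset.mem_insert_self _ _)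
        · exact .inr (.inl (Finset.mem_erase.2 ⟨hρk, h1⟩))
      · exact .inr (.inr h1)
    generator := fun ν hν => by
      obtain ⟨c, hc, hs⟩ := h.generator ν hν
      exact ⟨c, Finset.mem_insert_of_mem hc, hs⟩
    resolved := fun a ha b hb hab hai => by
      dsimp only at ha hb
      rcases Finset.mem_insert.1 ha with rfl | ha' <;> rcases Finset.mem_insert.1 hb with rfl | hb'
      · exact absurd rfl hab
      · rcases resolved_or_exists_critPair (M := M) (ord := ord) (i := f.i) (prev := f.prev) a b
          with h1 | ⟨p, hp, hj⟩
        · exact .inl h1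
        · exact .inr ⟨p, .inr ⟨b, hb', hp⟩, hj⟩
      · rcases resolved_or_exists_critPair (M := M) (ord := ord) (i := f.i) (prev := f.prev) b a
          with h1 | ⟨p, hp, hj⟩
        · exact .inl h1.symm
        · exact .inr ⟨p, .inr ⟨a, ha', hp⟩, hj.symm⟩
      · exact (h.resolved a ha' b hb' hab hai).imp_right fun ⟨p, hp, hj⟩ => ⟨p, .inl hp, hj⟩
    pend_valid := fun p hp => by
      rcases hp with hp | ⟨j, hj, hp⟩
      · exact (h.pend_valid p hp).mono (Finset.subset_insert _ _)
      · exact valid_of_mem_critPair hp (Finset.mem_insert_self _ _) (Finset.mem_insert_of_mem hj)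
          (fun hkj => hkc (hkj ▸ hj)) hki (h.index_le j (h.cur_spec j hj).1)
    cover := h.cover }

theorem Sig.index_le_of_not_lt {s t : Sig n m} (h : ¬ Sig.Lt ord s t) : t.2 ≤ s.2 :=
  not_lt.1 fun hlt => h (.inl hlt)

/-- The covering property below `i` makes the elements of `G` a Gröbner basis. -/
theorem exists_degree_le {G : Finset ℕ} {i : ℕ}
    (h : ∀ s : Sig n m, (s.2 : ℕ) < i → MinCover ord F M G s) {p : MvPolynomial (Fin n) K}
    (hp : p ∈ partialIdeal F i) (h0 : p ≠ 0) :
    ∃ k ∈ G, ord.degree (M.poly k) ≤ ord.degree p := by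
  obtain ⟨s, hs, hlab⟩ := exists_labels_of_mem_partialIdeal (ord := ord) hp h0
  obtain ⟨τ, _, _, k, hk, u, _, _, hdeg⟩ := exists_cover (M := M) (G := G)
    (fun t ht => h t (lt_of_le_of_lt (Fin.le_def.1 (Sig.index_le_of_not_lt ht)) hs)) hlab h0
  exact ⟨k, hk, hdeg ▸ le_add_self⟩

/-- Generation follows from divisibility of head monomials: the remainder of an element of `I` on
division by `B` lies in `I`, and its head monomial is irreducible, so it is zero. -/
theorem isGroebnerBasis_of_exists_dvd {B : Set (MvPolynomial (Fin n) K)}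
    {I : Ideal (MvPolynomial (Fin n) K)} (hfin : B.Finite) (hB : B ⊆ I) (h0 : ∀ b ∈ B, b ≠ 0)
    (hdvd : ∀ p ∈ I, p ≠ 0 → ∃ b ∈ B, ord.degree b ≤ ord.degree p) :
    IsGroebnerBasis ord B I where
  finite := hfin
  span_eq := by
    refine le_antisymm (Ideal.span_le.2 hB) fun p hp => ?_
    obtain ⟨g, r, hgr, _, hr⟩ := ord.div_set (B := B)
      (fun b hb => (ord.leadingCoeff_ne_zero_iff.2 (h0 b hb)).isUnit) p
    have hg : Finsupp.linearCombination _ (fun b : B => (b : MvPolynomial (Fin n) K)) g ∈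
        Ideal.span B := by
      have := (Finsupp.mem_span_range_iff_exists_finsupp (R := MvPolynomial (Fin n) K)
        (v := fun b : B => (b : MvPolynomial (Fin n) K))).2 ⟨g, rfl⟩
      rwa [Subtype.range_coe] at this
    have hrI : r ∈ I := by
      have := I.sub_mem hp (Ideal.span_le.2 hB hg)
      rwa [hgr, add_sub_cancel_left] at this
    have hr0 : r = 0 := by
      by_contra hne
      obtain ⟨b, hb, hle⟩ := hdvd r hrI hne
      exact hr _ (ord.degree_mem_support hne) b hb hle
    rw [hgr, hr0, add_zero]
    exact hg
  exists_dvd := fun p hp hp0 => by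
    obtain ⟨b, hb, hle⟩ := hdvd p hp hp0
    exact ⟨b, hb, h0 b hb, hle⟩

/-- With no pair pending and no active position, every rule belongs to a current generator or to a
zero polynomial, and all pairs are resolved. -/
theorem StageInv.minCover (h : StageInv ord F M f ∅ ∅) (s : Sig n m) (hs : s.2 ≤ f.i) :
    MinCover ord F M f.cur s := by
  refine minCover_of_resolved (i := f.i) (prev := f.prev) (fun t ht => ?_) (fun s hs => ?_)
    (fun k hk l hl hkl hki => ?_) (fun s hs p hp hp0 hmin => ?_) s hs
  -- A monomial that is top-reducible by `prev` belongs to the signature of a multiple of a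
  -- principal-type syzygy, since `poly l` lies in the ideal of the preceding generators.
  · obtain ⟨l, hl, hle⟩ := ht
    obtain ⟨hls, hl0⟩ := h.cur_spec l (h.prev_subset hl)
    exact labels_zero_of_le (partialIdeal_mono (Nat.succ_le_of_lt (Fin.lt_def.1 (h.prev_index l hl)))
      (h.labels l hls).mem_partialIdeal) hl0 hle
  · obtain ⟨c, hc, hcs⟩ := h.generator s.2 hs.le
    obtain ⟨k, u, hk, hu, hrw⟩ := h.rules.exists_not_rewritten s hcs
    have hk' : k < M.size ∧ (k ∈ f.cur ∨ M.poly k = 0) := by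
      rcases hk with rfl | ⟨ρ, hρ, rfl⟩
      · exact ⟨(h.cur_spec k hc).1, .inl hc⟩
      · exact ⟨(h.rules.sig_eq _ _ hρ).1, by simpa using h.rule_spec _ ρ hρ⟩
    exact ⟨k, u, hu, hrw, h.labels k hk'.1, hk'.2⟩
  · simpa using h.resolved k hk l hl hkl hki
  · obtain ⟨k, hk, hk'⟩ := h.cover s hs p hp hp0 hmin
    exact ⟨k, h.prev_subset hk, hk'⟩

theorem StageInv.basisInv (h : StageInv ord F M f ∅ ∅) :
    BasisInv ord F M (f.i + 1) f.cur {p | ∃ l ∈ f.cur, M.poly l = p} := by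
  have hcover : ∀ s : Sig n m, (s.2 : ℕ) < f.i + 1 → MinCover ord F M f.cur s :=
    fun s hs => h.minCover s (Fin.le_def.2 (Nat.lt_succ_iff.1 hs))
  have hmem : ∀ k ∈ f.cur, M.poly k ∈ partialIdeal F (f.i + 1) := fun k hk =>
    partialIdeal_mono (Nat.succ_le_succ (Fin.le_def.1 (h.index_le k (h.cur_spec k hk).1)))
      (h.labels k (h.cur_spec k hk).1).mem_partialIdeal
  refine
  { rules := h.rules
    labels := h.labels
    index_lt := fun k hk => Nat.lt_succ_of_le (Fin.le_def.1 (h.index_le k hk))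
    prev_spec := h.cur_spec
    rule_spec := fun ν ρ hρ => by simpa using h.rule_spec ν ρ hρ
    generator := fun ν hν => h.generator ν (Fin.le_def.2 (Nat.lt_succ_iff.1 hν))
    cover := hcover
    groebner := isGroebnerBasis_of_exists_dvd ?_ ?_ ?_ fun p hp hp0 => ?_ }
  · exact (f.cur.finite_toSet.image M.poly).subset fun p ⟨l, hl, hp⟩ => ⟨l, hl, hp⟩
  · rintro _ ⟨l, hl, rfl⟩
    exact hmem l hl
  · rintro _ ⟨l, hl, rfl⟩
    exact (h.cur_spec l hl).2
  · obtain ⟨k, hk, hle⟩ := exists_degree_le hcover hp hp0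
    exact ⟨_, ⟨k, hk, rfl⟩, hle⟩

end Invariant

end F5

namespace F5

/-! ### Preservation of the invariant by all steps -/

section Steps

variable {K : Type*} [Field K] {n m : ℕ} {ord : MonomialOrder (Fin n)}
  {F : Fin m → MvPolynomial (Fin n) K}

/-- The invariant of a run of F5. -/
def Config.Inv (ord : MonomialOrder (Fin n)) (F : Fin m → MvPolynomial (Fin n) K) :
    Config K n m → Prop
  | .basis M i prev B => BasisInv ord F M i prev B
  | .partialBasis M f => StageInv ord F M f {p | p ∈ f.pairs} ∅
  | .spols M f rest newpols => StageInv ord F M f {p | p ∈ f.pairs ∨ p ∈ rest} newpols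
  | .reduction M f todo completed =>
      StageInv ord F M f {p | p ∈ f.pairs} (todo ∪ completed) ∧
        (∀ k ∈ completed, M.poly k ≠ 0) ∧ Disjoint todo completed
  | .topReduction M f todo completed k =>
      StageInv ord F M f {p | p ∈ f.pairs} (insert k (todo ∪ completed)) ∧
        (∀ j ∈ completed, M.poly j ≠ 0) ∧ Disjoint todo completed ∧ k ∉ todo ∧ k ∉ completed
  | .update M f reduced =>
      StageInv ord F M f {p | p ∈ f.pairs} reduced ∧ ∀ k ∈ reduced, M.poly k ≠ 0
  | .halted G => IsGroebnerBasis ord G (Ideal.span (Set.range F))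

theorem partialIdeal_eq_span_range {i : ℕ} (hi : m ≤ i) :
    partialIdeal F i = Ideal.span (Set.range F) := by
  have : {j : Fin m | (j : ℕ) < i} = Set.univ := Set.eq_univ_of_forall fun j => j.2.trans_le hi
  rw [partialIdeal, this, Set.image_univ]

theorem partialIdeal_le_span_range (i : ℕ) : partialIdeal F i ≤ Ideal.span (Set.range F) :=
  Ideal.span_mono (Set.image_subset_range _ _)

theorem BasisInv.stageInv {M : Memory K n m} {i : ℕ} {prev : Finset ℕ}
    {B : Set (MvPolynomial (Fin n) K)} (h : BasisInv ord F M i prev B) (hi : i < m)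
    (hF : F ⟨i, hi⟩ ≠ 0) :
    StageInv ord F (M.append (0, ⟨i, hi⟩) (monic ord (F ⟨i, hi⟩)))
      { i := ⟨i, hi⟩, B := B, prev := prev, cur := insert M.size prev,
        pairs := prev.biUnion fun j => critPair ord
          (M.append (0, ⟨i, hi⟩) (monic ord (F ⟨i, hi⟩))) M.size j ⟨i, hi⟩ prev }
      {p | p ∈ prev.biUnion fun j => critPair ord
          (M.append (0, ⟨i, hi⟩) (monic ord (F ⟨i, hi⟩))) M.size j ⟨i, hi⟩ prev} ∅ := by
  set c : Sig n m := (0, ⟨i, hi⟩) with hc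
  set M' := M.append c (monic ord (F ⟨i, hi⟩)) with hM'
  have hprev : ∀ k ∈ prev, k < M.size := fun k hk => (h.prev_spec k hk).1
  have hext : M.Extends M' prev ⟨i, hi⟩ := Memory.extends_append hprev c _
  have hindex : ∀ k < M.size, (M'.sig k).2 < ⟨i, hi⟩ := fun k hk => by
    rw [hext.sig_eq k hk]
    exact Fin.lt_def.2 (h.index_lt k hk)
  have hsize : M'.sig M.size = c := Memory.sig_append_size c _
  have hpoly : M'.poly M.size = monic ord (F ⟨i, hi⟩) := Memory.poly_append_size c _
  have hlt : ∀ k < M'.size, k < M.size ∨ k = M.size := fun k hk => (Nat.lt_succ_iff.1 hk).lt_or_eq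
  exact
  { rules := h.rules.append (fun k hk heq => (h.index_lt k hk).ne (congrArg Fin.val heq)) _
    labels := fun k hk => by
      rcases hlt k hk with hk | rfl
      · rw [hext.sig_eq k hk, Memory.poly_append_of_lt hk]
        exact h.labels k hk
      · rw [hsize, hpoly]
        exact (labels_generator _).monic
    index_le := fun k hk => by
      rcases hlt k hk with hk | rfl
      · exact (hindex k hk).le
      · rw [hsize]
    subset_ideal := fun b hb => h.groebner.span_eq ▸ Ideal.subset_span hb
    prev_subset := Finset.subset_insert _ _
    prev_index := fun k hk => hindex k (hprev k hk)
    cur_spec := fun k hk => by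
      rcases Finset.mem_insert.1 hk with rfl | hk
      · exact ⟨Nat.lt_succ_self _, hpoly ▸ monic_ne_zero hF⟩
      · rw [hext.poly_eq k hk]
        exact ⟨(hprev k hk).trans (Nat.lt_succ_self _), (h.prev_spec k hk).2⟩
    act_spec := by simp
    rule_spec := fun ν ρ hρ => by
      rw [hM', Memory.poly_append_of_lt (h.rules.sig_eq ν ρ hρ).1]
      exact (h.rule_spec ν ρ hρ).imp Finset.mem_insert_of_mem .inr
    generator := fun ν hν => by
      rcases hν.lt_or_eq with hν | rfl
      · obtain ⟨k, hk, hs⟩ := h.generator ν (Fin.lt_def.1 hν)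
        exact ⟨k, Finset.mem_insert_of_mem hk, by rw [hext.sig_eq k (hprev k hk), hs]⟩
      · exact ⟨M.size, Finset.mem_insert_self _ _, hsize⟩
    resolved := fun k hk l hl hkl hki => by
      dsimp only at hk hl
      rcases Finset.mem_insert.1 hk with rfl | hk'
      · have hl' := (Finset.mem_insert.1 hl).resolve_left hkl.symm
        refine (resolved_or_exists_critPair M.size l).imp_right fun ⟨p, hp, hj⟩ => ⟨p, ?_, hj⟩
        exact Finset.mem_biUnion.2 ⟨l, hl', hp⟩
      · exact absurd hki (hindex k (hprev k hk')).ne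
    pend_valid := fun p hp => by
      obtain ⟨l, hl, hp⟩ := Finset.mem_biUnion.1 hp
      exact valid_of_mem_critPair hp (Finset.mem_insert_self _ _) (Finset.mem_insert_of_mem hl)
        (hprev l hl).ne' (by rw [hsize]) (hindex l (hprev l hl)).le
    cover := fun s hs => hext.minCover (Finset.Subset.refl _)
      (fun k hk => ⟨hprev k hk, fun heq => (h.index_lt k (hprev k hk)).ne (congrArg Fin.val heq)⟩)
      (h.cover s (Fin.lt_def.1 hs)) }

theorem Memory.update_rules_nil {M : Memory K n m} {i : Fin m} (h : M.rules i = []) :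
    { M with rules := Function.update M.rules i [] } = M := by
  rw [← h, Function.update_eq_self]

theorem StageInv.isGroebnerBasis_one {M : Memory K n m} {f : Frame K n m}
    {pend : Set (CritPair n)} {act : Finset ℕ} (h : StageInv ord F M f pend act)
    (h1 : ∃ l ∈ f.cur, M.poly l = 1) : IsGroebnerBasis ord {1} (Ideal.span (Set.range F)) := by
  obtain ⟨l, hl, hl1⟩ := h1
  have hmem := partialIdeal_le_span_range _
    (h.labels l (h.cur_spec l hl).1).mem_partialIdeal
  rw [hl1] at hmem
  refine isGroebnerBasis_of_exists_dvd (Set.finite_singleton _) (by simpa using hmem) (by simp)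
    fun p _ _ => ⟨1, rfl, ?_⟩
  simp

theorem Config.Inv.step (hF : ∀ i, F i ≠ 0) {c c' : Config K n m} (hc : c.Inv ord F)
    (hstep : Step ord F c c') : c'.Inv ord F := by
  cases hstep with
  | basis_return M i prev B hi =>
    have := BasisInv.groebner hc
    rwa [partialIdeal_eq_span_range hi] at this
  | basis_next M M' i prev B hi hM' =>
    subst hM'
    -- No position has index `i` yet, so the list of rules that is reset was already empty.
    have hnil : M.rules ⟨i, hi⟩ = [] := by
      refine List.eq_nil_iff_forall_not_mem.2 fun ρ hρ => ?_
      obtain ⟨h1, h2⟩ := (BasisInv.rules hc).sig_eq _ ρ hρ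
      have := BasisInv.index_lt hc _ h1
      rw [h2] at this
      exact lt_irrefl _ this
    rw [Memory.update_rules_nil (M := M.append _ _) hnil]
    exact BasisInv.stageInv hc hi (hF _)
  | partial_return_one M f hP h1 => exact StageInv.isGroebnerBasis_one hc h1
  | partial_return M f hP h1 =>
    have hc : StageInv ord F M f {p | p ∈ f.pairs} ∅ := hc
    simp only [hP, Finset.notMem_empty, Set.ofPred_false] at hc
    exact hc.basisInv
  | partial_select M f d L hd hnodup hL hsort =>
    have hc : StageInv ord F M f {p | p ∈ f.pairs} ∅ := hc
    have heq : {p | p ∈ f.pairs.filter (fun p => p.t.degree ≠ d) ∨ p ∈ L} =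
        {p | p ∈ f.pairs} := by
      ext p
      simp only [Set.mem_ofPred_eq, Finset.mem_filter, hL]
      tauto
    have := hc.with_pairs (f.pairs.filter fun p => p.t.degree ≠ d)
    rw [← heq] at this
    exact this
  | spols_skip M f p L newpols h =>
    have hc : StageInv ord F M f {q | q ∈ f.pairs ∨ q ∈ p :: L} newpols := hc
    refine hc.discharge (fun q hq => hq.imp_right (List.mem_cons_of_mem _)) fun q hq hq' => ?_
    have hqp : q = p := by
      simp only [Set.mem_ofPred_eq, List.mem_cons] at hq hq'
      tauto
    subst hqp
    have hv := hc.pend_valid q hq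
    rwa [hc.rules.isRewritable_iff (hc.cur_spec _ hv.k_mem).1,
      hc.rules.isRewritable_iff (hc.cur_spec _ hv.l_mem).1] at h
  | spols_zero M f p L newpols hk hl hs =>
    have hc : StageInv ord F M f {q | q ∈ f.pairs ∨ q ∈ p :: L} newpols := hc
    have := hc.processPair (p := p) (pend' := {q | q ∈ f.pairs ∨ q ∈ L}) (.inr (by simp))
      (fun q hq => hq.imp_right (List.mem_cons_of_mem _))
      (fun q hq => by
        simp only [Set.mem_ofPred_eq, List.mem_cons] at hq ⊢
        tauto) hk hl
    rw [hs] at this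
    refine this.restrict (Finset.subset_insert _ _) fun k hk hk' => ?_
    rw [(Finset.mem_insert.1 hk).resolve_right hk']
    simp
  | spols_add M f p L newpols hk hl hs =>
    have hc : StageInv ord F M f {q | q ∈ f.pairs ∨ q ∈ p :: L} newpols := hc
    exact hc.processPair (p := p) (pend' := {q | q ∈ f.pairs ∨ q ∈ L}) (.inr (by simp))
      (fun q hq => hq.imp_right (List.mem_cons_of_mem _))
      (fun q hq => by
        simp only [Set.mem_ofPred_eq, List.mem_cons] at hq ⊢
        tauto) hk hl
  | spols_return M f newpols =>
    have hc : StageInv ord F M f {q | q ∈ f.pairs ∨ q ∈ []} newpols := hc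
    simp only [List.not_mem_nil, or_false] at hc
    exact ⟨by simpa using hc, by simp, by simp⟩
  | reduction_select M f todo completed k h hk hmin hnf =>
    obtain ⟨h1, h2, h3⟩ := hc
    have hkc : k ∉ completed := Finset.disjoint_left.1 h3 hk
    have hact : k ∈ todo ∪ completed := Finset.mem_union_left _ hk
    have heq : insert k (todo.erase k ∪ completed) = todo ∪ completed := by
      rw [← Finset.insert_union, Finset.insert_erase hk]
    refine ⟨?_, fun j hj => ?_, h3.mono_left (Finset.erase_subset _ _),
      Finset.notMem_erase _ _, hkc⟩
    · rw [heq]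
      obtain ⟨hks, _, hki, _⟩ := h1.act_spec k hact
      -- The normal form is `poly k` minus an element of the ideal of the preceding generators.
      have hlab := (h1.labels k hks).sub_of_mem
        (q := M.poly k - h) (by rw [hki]; exact hnf.sub_mem h1.subset_ideal)
      rw [sub_sub_cancel] at hlab
      exact h1.setPoly hact hlab
    · rw [Memory.poly_setPoly_of_ne (ne_of_mem_of_not_mem hj hkc)]
      exact h2 j hj
  | reduction_return M f completed =>
    obtain ⟨h1, h2, _⟩ := hc
    exact ⟨by simpa using h1, h2⟩
  | top_zero M f todo completed k hk =>
    obtain ⟨h1, h2, h3, _, _⟩ := hc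
    refine ⟨h1.restrict (Finset.subset_insert _ _) fun j hj hj' => ?_, h2, h3⟩
    rwa [(Finset.mem_insert.1 hj).resolve_right hj']
  | top_complete M f todo completed k hk hJ =>
    obtain ⟨h1, h2, h3, h4, h5⟩ := hc
    have hact := Finset.mem_insert_self k (todo ∪ completed)
    refine ⟨?_, fun j hj => ?_, Finset.disjoint_insert_right.2 ⟨h4, h3⟩⟩
    · rw [Finset.union_insert]
      exact h1.setPoly hact (h1.labels k (h1.act_spec k hact).1).monic
    · rcases Finset.mem_insert.1 hj with rfl | hj
      · rw [Memory.poly_setPoly_self]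
        exact monic_ne_zero hk
      · rw [Memory.poly_setPoly_of_ne (ne_of_mem_of_not_mem hj h5)]
        exact h2 j hj
  | top_safe M f todo completed k j u hk hj hu hs =>
    obtain ⟨h1, h2, h3, h4, h5⟩ := hc
    have hact := Finset.mem_insert_self k (todo ∪ completed)
    have hj' : j < M.size ∧ M.poly j ≠ 0 := by
      rcases Finset.mem_union.1 hj.1 with h | h
      · exact h1.cur_spec j h
      · exact ⟨(h1.act_spec j (by simp [h])).1, h2 j h⟩
    refine ⟨?_, fun l hl => ?_, Finset.disjoint_insert_left.2 ⟨h5, h3⟩⟩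
    · rw [Finset.insert_union]
      refine h1.setPoly hact ?_
      subst hu
      exact (h1.labels k (h1.act_spec k hact).1).topReduct_of_lt (h1.labels j hj'.1) hk hj'.2 hs
    · rw [Memory.poly_setPoly_of_ne (ne_of_mem_of_not_mem hl h5)]
      exact h2 l hl
  | top_unsafe M f todo completed k j u hk hj hu hs =>
    obtain ⟨h1, h2, h3, h4, h5⟩ := hc
    subst hu
    have hact := Finset.mem_insert_self k (todo ∪ completed)
    obtain ⟨hks, _, hki, _⟩ := h1.act_spec k hact
    have hj' : j < M.size ∧ M.poly j ≠ 0 := by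
      rcases Finset.mem_union.1 hj.1 with h | h
      · exact h1.cur_spec j h
      · exact ⟨(h1.act_spec j (by simp [h])).1, h2 j h⟩
    have hcomp : ∀ l ∈ completed, l < M.size := fun l hl => (h1.act_spec l (by simp [hl])).1
    have hlt : Sig.Lt ord (M.sig k)
        (Sig.mul (ord.degree (M.poly k) - ord.degree (M.poly j)) (M.sig j)) := by
      rcases Sig.lt_or_eq_or_gt ord (M.sig k)
        (Sig.mul (ord.degree (M.poly k) - ord.degree (M.poly j)) (M.sig j)) with h | h | h
      · exact h
      · exact absurd h.symm hj.2.2.1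
      · exact absurd h hs
    -- The multiple of `sig j` exceeds `sig k`, which has the current index, so `j` has that index
    -- too. That its monomial passes the criterion is part of being a reductor.
    have hji : (M.sig j).2 = f.i := le_antisymm (h1.index_le j hj'.1) (hki ▸ hlt.index_le)
    have hlab := (h1.labels k hks).topReduct_of_gt (h1.labels j hj'.1) hk hj'.2 hlt
    refine ⟨?_, fun l hl => ?_, ?_⟩
    · rw [Finset.insert_union, Finset.insert_union, Finset.insert_comm]
      exact h1.appendWithRule
        (s := Sig.mul (ord.degree (M.poly k) - ord.degree (M.poly j)) (M.sig j)) hji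
        hj.2.2.2.2 hlab
    · rw [Memory.poly_appendWithRule, Memory.poly_append_of_lt (hcomp l hl)]
      exact h2 l hl
    · refine Finset.disjoint_insert_left.2 ⟨h5, Finset.disjoint_insert_left.2 ⟨fun h => ?_, h3⟩⟩
      exact lt_irrefl _ (hcomp _ h)
  | update_next M f reduced k hk =>
    obtain ⟨h1, h2⟩ := hc
    refine ⟨?_, fun j hj => h2 j (Finset.mem_of_mem_erase hj)⟩
    have := h1.addCritPairs hk (h2 k hk)
      (f.pairs ∪ f.cur.biUnion fun j => critPair ord M k j f.i f.prev)
    convert this using 1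
    ext p
    simp
  | update_return M f => exact hc.1

theorem Config.inv_start [NeZero m] (hF : ∀ i, F i ≠ 0) : (start ord F).Inv ord F := by
  have hlab := labels_generator (ord := ord) (F := F) 0
  -- A label of index `0` comes from a vector with a single component, so the polynomial is a
  -- multiple of the first generator and its head monomial is determined by the label.
  have hdeg : ∀ s : Sig n m, (s.2 : ℕ) < 1 → ∀ p, Labels ord F s p →
      s.2 = 0 ∧ s.1 + ord.degree (F 0) = ord.degree p := by
    rintro ⟨μ, ν⟩ hs p ⟨h, ⟨h1, h2, h3⟩, rfl⟩
    obtain rfl : ν = 0 := Fin.ext (by simpa using hs)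
    refine ⟨rfl, ?_⟩
    rw [Finset.sum_eq_single 0 (fun j _ hj => by rw [h3 j (Fin.pos_iff_ne_zero.2 hj), zero_mul])
      (by simp), ord.degree_mul h1 (hF 0), h2]
  refine
  { rules := ⟨by simp, by simp, fun k hk => .inr fun j hj _ => ?_⟩
    labels := fun k _ => hlab.monic
    index_lt := fun k _ => by simp [Memory.sig]
    prev_spec := fun k hk => ⟨by simpa using hk, monic_ne_zero (hF 0)⟩
    rule_spec := by simp
    generator := fun ν hν => ⟨0, by simp, ?_⟩
    cover := fun s hs p hp hp0 hmin => ⟨0, by simp, s.1, ?_, ?_, ?_⟩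
    groebner := isGroebnerBasis_of_exists_dvd (Set.finite_singleton _) ?_ ?_ fun p hp hp0 => ?_ }
  · exact (Nat.lt_one_iff.1 hk).le.trans (Nat.zero_le _)
  · exact Prod.ext rfl (Fin.ext (by simpa [Memory.sig] using (Nat.lt_one_iff.1 hν).symm))
  · exact Prod.ext (add_zero _) (hdeg s hs p hp).1.symm
  · rintro ⟨ρ, hρ, _⟩
    simp at hρ
  · rw [← (hdeg s hs p hp).2]
    exact congrArg _ (degree_monic (hF 0))
  · rintro _ rfl
    exact Ideal.subset_span ⟨0, by simp, rfl⟩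
  · rintro _ rfl
    exact hF 0
  · obtain ⟨s, hs, hlab⟩ := exists_labels_of_mem_partialIdeal (ord := ord) hp hp0
    exact ⟨_, rfl, (hdeg s hs p hlab).2 ▸ le_add_self⟩

theorem Config.inv_of_reflTransGen [NeZero m] (hF : ∀ i, F i ≠ 0) {c : Config K n m}
    (h : Relation.ReflTransGen (Step ord F) (start ord F) c) : c.Inv ord F := by
  induction h with
  | refl => exact Config.inv_start hF
  | tail _ hstep ih => exact ih.step hF hstep

/-- If the syzygies of `F` have their leading components in the ideals of the preceding
generators, then zero has no label that passes the criterion. -/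
theorem StageInv.topReducible_of_labels_zero {M : Memory K n m} {f : Frame K n m}
    {pend : Set (CritPair n)} {act : Finset ℕ} (h : StageInv ord F M f pend act)
    (hsyz : ∀ (i : Fin m) (g : Fin m → MvPolynomial (Fin n) K), ∑ j, g j * F j = 0 →
      (∀ j, i < j → g j = 0) → g i ∈ partialIdeal F i) {s : Sig n m} (hs : s.2 = f.i)
    (h0 : Labels ord F s 0) : M.TopReducible ord f.prev s.1 := by
  obtain ⟨g, ⟨g1, g2, g3⟩, hg⟩ := h0
  have hmem := hsyz s.2 g hg g3
  rw [← g2]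
  exact exists_degree_le (fun t ht => h.cover t (hs ▸ Fin.lt_def.2 ht)) hmem g1

/-- A zero polynomial would make its own signature a label of zero, hence top-reducible by the
previous basis; active positions and valid pairs have passed exactly this test. -/
theorem Config.Inv.not_isZeroReduction
    (hsyz : ∀ (i : Fin m) (g : Fin m → MvPolynomial (Fin n) K), ∑ j, g j * F j = 0 →
      (∀ j, i < j → g j = 0) → g i ∈ partialIdeal F i) {c : Config K n m} (hc : c.Inv ord F) :
    ¬ IsZeroReduction ord c := by
  rintro (⟨M, f, todo, completed, k, hk⟩ | ⟨M, f, p, L, newpols, hk, hl, hs⟩)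
  · obtain ⟨hks, _, hki, htr⟩ := hc.1.act_spec k (Finset.mem_insert_self _ _)
    exact htr (hc.1.topReducible_of_labels_zero hsyz hki (hk ▸ hc.1.labels k hks))
  · have hc : StageInv ord F M f {q | q ∈ f.pairs ∨ q ∈ p :: L} newpols := hc
    have hv := hc.pend_valid p (.inr (by simp))
    have hlab := hv.labels_sPolynomial hc.rules hc.cur_spec hc.labels hk hl
    rw [hs] at hlab
    exact hv.not_topReducible
      (hc.topReducible_of_labels_zero hsyz (s := Sig.mul p.u (M.sig p.k)) hv.index_eq hlab)

end Steps

end F5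

namespace F5

/-! ### Homogeneous components with integer degrees -/

section GradedPart

variable {K : Type*} [Field K] {n : ℕ}

/-- The homogeneous component of degree `z`, which is zero if `z` is negative. -/
noncomputable def gradedPart (z : ℤ) : MvPolynomial (Fin n) K →ₗ[K] MvPolynomial (Fin n) K :=
  if 0 ≤ z then homogeneousComponent z.toNat else 0

theorem coeff_gradedPart (z : ℤ) (p : MvPolynomial (Fin n) K) (s : Fin n →₀ ℕ) :
    (gradedPart z p).coeff s = if (s.degree : ℤ) = z then p.coeff s else 0 := by
  unfold gradedPart
  split_ifs with h1 h2 h2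
  · rw [coeff_homogeneousComponent, if_pos (by omega)]
  · rw [coeff_homogeneousComponent, if_neg (by omega)]
  · omega
  · simp

theorem gradedPart_of_neg {z : ℤ} (hz : z < 0) (p : MvPolynomial (Fin n) K) :
    gradedPart z p = 0 := by
  rw [gradedPart, if_neg (not_le.2 hz), LinearMap.zero_apply]

theorem gradedPart_gradedPart (z : ℤ) (p : MvPolynomial (Fin n) K) :
    gradedPart z (gradedPart z p) = gradedPart z p := by
  ext s
  rw [coeff_gradedPart, coeff_gradedPart]
  split_ifs <;> rfl

/-- Integer degrees avoid truncated subtraction: for `z < e` both sides vanish. -/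
theorem gradedPart_mul {e : ℕ} {q : MvPolynomial (Fin n) K} (hq : q.IsHomogeneous e) (z : ℤ)
    (p : MvPolynomial (Fin n) K) : gradedPart z (p * q) = gradedPart (z - e) p * q := by
  classical
  let := gradedAlgebra (σ := Fin n) (R := K)
  rcases lt_or_ge z 0 with hz | hz
  · rw [gradedPart_of_neg hz, gradedPart_of_neg (by omega), zero_mul]
  have key : homogeneousComponent z.toNat (p * q) =
      if e ≤ z.toNat then homogeneousComponent (z.toNat - e) p * q else 0 := by
    rw [← decomposition.decompose'_apply, ← decomposition.decompose'_apply]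
    exact DirectSum.coe_decompose_mul_of_right_mem (homogeneousSubmodule (Fin n) K) z.toNat
      (a := p) ((mem_homogeneousSubmodule e q).2 hq)
  rw [gradedPart, if_pos hz, key]
  split_ifs with h
  · rw [gradedPart, if_pos (by omega)]
    congr 3
    omega
  · rw [gradedPart_of_neg (by omega), zero_mul]

theorem sum_gradedPart {p : MvPolynomial (Fin n) K} {e N : ℕ} (hN : p.totalDegree + e < N) :
    ∑ d ∈ Finset.range N, gradedPart ((d : ℤ) - e) p = p := by
  classical
  ext s
  rw [coeff_sum]
  simp only [coeff_gradedPart]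
  by_cases hs : p.coeff s = 0
  · simp [hs]
  · have hle : s.degree ≤ p.totalDegree := le_totalDegree (mem_support_iff.2 hs)
    rw [Finset.sum_eq_single (s.degree + e)]
    · rw [if_pos (by push_cast; ring)]
    · intro d _ hd
      rw [if_neg (by omega)]
    · intro h
      exact absurd (Finset.mem_range.2 (by omega)) h

end GradedPart

/-! ### Descent of Koszul exactness to initial segments -/

section Koszul

variable {K : Type*} [Field K] {n m : ℕ} {F : Fin m → MvPolynomial (Fin n) K}

/-- `h` is a combination of the principal syzygies of the first `l` members of `F`, written by
means of the alternating matrix of coefficients. -/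
def IsKoszul (F : Fin m → MvPolynomial (Fin n) K) (l : ℕ)
    (h : Fin m → MvPolynomial (Fin n) K) : Prop :=
  ∃ A : Fin m → Fin m → MvPolynomial (Fin n) K, (∀ j k, A j k = -A k j) ∧ (∀ j, A j j = 0) ∧
    (∀ j k : Fin m, l ≤ (k : ℕ) → A j k = 0) ∧ ∀ j, h j = ∑ k, A j k * F k

/-- Every syzygy of the first `l` members of `F` is a combination of principal ones. -/
def KoszulExact (F : Fin m → MvPolynomial (Fin n) K) (l : ℕ) : Prop :=
  ∀ h : Fin m → MvPolynomial (Fin n) K, ∑ j, h j * F j = 0 →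
    (∀ j : Fin m, l ≤ (j : ℕ) → h j = 0) → IsKoszul F l h

theorem IsKoszul.zero (l : ℕ) : IsKoszul F l 0 :=
  ⟨0, by simp, by simp, by simp, by simp⟩

theorem IsKoszul.add {l : ℕ} {g h : Fin m → MvPolynomial (Fin n) K} (hg : IsKoszul F l g)
    (hh : IsKoszul F l h) : IsKoszul F l (g + h) := by
  obtain ⟨A, a1, a2, a3, a4⟩ := hg
  obtain ⟨B, b1, b2, b3, b4⟩ := hh
  refine ⟨A + B, fun j k => ?_, fun j => ?_, fun j k hk => ?_, fun j => ?_⟩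
  · rw [Pi.add_apply, Pi.add_apply, Pi.add_apply, Pi.add_apply, a1 j k, b1 j k, neg_add]
  · simp [a2, b2]
  · simp [a3 j k hk, b3 j k hk]
  · simp [a4 j, b4 j, add_mul, Finset.sum_add_distrib]

theorem IsKoszul.sum {l : ℕ} {ι : Type*} (S : Finset ι)
    {h : ι → Fin m → MvPolynomial (Fin n) K} (hh : ∀ d ∈ S, IsKoszul F l (h d)) :
    IsKoszul F l (∑ d ∈ S, h d) :=
  Finset.sum_induction h (IsKoszul F l) (fun _ _ => IsKoszul.add) (IsKoszul.zero l) hh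

/-- The last of the generators, if it is homogeneous of positive degree, may be omitted: graded
case. -/
theorem KoszulExact.isKoszul_of_graded {δ : Fin m → ℕ} (hδ : ∀ j, (F j).IsHomogeneous (δ j))
    {l : Fin m} (hl : 0 < δ l) (hex : KoszulExact F (l + 1)) (N : ℕ) :
    ∀ d : ℤ, d < N → ∀ h : Fin m → MvPolynomial (Fin n) K,
      (∀ j, gradedPart (d - δ j) (h j) = h j) → ∑ j, h j * F j = 0 →
      (∀ j : Fin m, (l : ℕ) ≤ j → h j = 0) → IsKoszul F l h := by
  classical
  induction N with
  | zero =>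
    intro d hd h hgr _ _
    refine ⟨0, by simp, by simp, by simp, fun j => ?_⟩
    rw [← hgr j, gradedPart_of_neg (by omega)]
    simp
  | succ N ih =>
    intro d hd h hgr hsyz hsupp
    -- The matrix from the longer segment may involve `F l`. Its entries are first cut down to the
    -- degrees forced by the grading of `h`.
    obtain ⟨A, a1, a2, a3, a4⟩ := hex h hsyz fun j hj => hsupp j (by omega)
    set A' : Fin m → Fin m → MvPolynomial (Fin n) K :=
      fun j k => gradedPart (d - δ j - δ k) (A j k) with hA'
    have a1' : ∀ j k, A' j k = -A' k j := fun j k => by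
      simp only [hA']
      rw [a1 j k, map_neg, sub_right_comm]
    have a2' : ∀ j, A' j j = 0 := fun j => by simp [hA', a2]
    have a3' : ∀ j k : Fin m, (l : ℕ) < k → A' j k = 0 := fun j k hk => by
      simp [hA', a3 j k hk]
    have a4' : ∀ j, h j = ∑ k, A' j k * F k := fun j => by
      rw [← hgr j, a4 j, map_sum]
      exact Finset.sum_congr rfl fun k _ => gradedPart_mul (hδ k) _ _
    -- As `h l = 0`, row `l` gives a relation; by alternation, column `l` of `A'` is a syzygy of the
    -- first `l` members. Its degree is smaller by `δ l > 0`, so the induction hypothesis applies.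
    obtain ⟨B, b1, b2, b3, b4⟩ := ih (d - δ l) (by omega) (fun j => A' j l)
      (fun j => by
        simp only [hA']
        rw [sub_right_comm, gradedPart_gradedPart])
      (by
        have := a4' l
        rw [hsupp l le_rfl] at this
        rw [← neg_eq_zero, ← Finset.sum_neg_distrib, this]
        exact Finset.sum_congr rfl fun k _ => by rw [a1' l k, neg_mul])
      (fun j hj => by
        rcases hj.lt_or_eq with hj | hj
        · rw [a1', a3' l j hj, neg_zero]
        · rw [← Fin.ext hj, a2'])
    have hBl : ∀ k, B l k = 0 := fun k => by rw [b1, b3 k l le_rfl, neg_zero]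
    -- Row and column `l` are deleted from `A'`, and the lost term `A' j l * F l` is restored by `F
    -- l * B`, which uses only the first `l` members.
    refine ⟨fun j k => A' j k - (if k = l then A' j l else 0) - (if j = l then A' l k else 0) +
      F l * B j k, fun j k => ?_, fun j => ?_, fun j k hk => ?_, fun j => ?_⟩
    · dsimp only
      rw [a1' j k, b1 j k, a1' j l, a1' l k]
      split_ifs <;> ring
    · dsimp only
      rw [a2', b2]
      split_ifs with hj
      · rw [hj, a2']
        ring
      · ring
    · dsimp only
      rw [b3 j k hk]
      rcases hk.lt_or_eq with hk | hk
      · rw [a3' j k hk, a3' l k hk, if_neg (fun h => by rw [h] at hk; exact lt_irrefl _ hk)]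
        simp
      · rw [← Fin.ext hk, if_pos rfl, a2']
        simp
    · by_cases hj : j = l
      · subst hj
        rw [hsupp j le_rfl]
        refine (Finset.sum_eq_zero fun k _ => ?_).symm
        by_cases hk : k = j
        · subst hk
          simp [a2', b2]
        · simp [hk, hBl]
      · have hsum : ∀ k, (A' j k - (if k = l then A' j l else 0) - (if j = l then A' l k else 0) +
            F l * B j k) * F k =
            A' j k * F k - (if k = l then A' j l * F l else 0) + F l * (B j k * F k) := fun k => by
          rw [if_neg hj]
          split_ifs with hk
          · rw [hk]
            ring
          · ring
        rw [Finset.sum_congr rfl fun k _ => hsum k, Finset.sum_add_distrib,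
          Finset.sum_sub_distrib, ← Finset.mul_sum, ← b4 j, ← a4' j, Finset.sum_ite_eq',
          if_pos (Finset.mem_univ _)]
        ring

/-- The last of the generators, if it is homogeneous of positive degree, may be omitted. -/
theorem KoszulExact.of_succ {δ : Fin m → ℕ} (hδ : ∀ j, (F j).IsHomogeneous (δ j))
    {l : Fin m} (hl : 0 < δ l) (hex : KoszulExact F (l + 1)) : KoszulExact F l := by
  intro h hsyz hsupp
  -- Exceeds every degree that occurs in the products `h j * F j`, so the graded pieces below `N`
  -- add up to `h`.
  set N := ∑ j, ((h j).totalDegree + δ j) + 1 with hN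
  have hlt : ∀ j, (h j).totalDegree + δ j < N := fun j =>
    Nat.lt_succ_of_le (Finset.single_le_sum (f := fun j => (h j).totalDegree + δ j)
      (fun _ _ => Nat.zero_le _) (Finset.mem_univ j))
  have hsum : h = ∑ d ∈ Finset.range N, fun j => gradedPart ((d : ℤ) - δ j) (h j) :=
    funext fun j => by rw [Finset.sum_apply, sum_gradedPart (hlt j)]
  rw [hsum]
  refine IsKoszul.sum _ fun d hd => ?_
  refine KoszulExact.isKoszul_of_graded hδ hl hex N d (by simpa using hd) _
    (fun j => gradedPart_gradedPart _ _) ?_ (fun j hj => by simp [hsupp j hj])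
  rw [← map_zero (gradedPart (K := K) (n := n) d), ← hsyz, map_sum]
  exact Finset.sum_congr rfl fun j _ => (gradedPart_mul (hδ j) _ _).symm

theorem koszulExact_of_syzygies
    (h : ∀ H : Fin m → MvPolynomial (Fin n) K, IsSyzygy F H →
      H ∈ Submodule.span (MvPolynomial (Fin n) K) (principalSyzygies F)) : KoszulExact F m := by
  classical
  intro H hH _
  refine Submodule.span_induction (p := fun H _ => IsKoszul F m H) ?_ ?_ ?_ ?_ (h H hH)
  · rintro _ ⟨i, j, rfl⟩
    -- Entry `1` at `(j, i)` and `-1` at `(i, j)`; they cancel if `i = j`.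
    refine ⟨fun a b => (if a = j ∧ b = i then 1 else 0) - (if a = i ∧ b = j then 1 else 0),
      fun a b => ?_, fun a => ?_, fun a b hb => absurd b.2 (not_lt.2 hb), fun a => ?_⟩
    · simp only [and_comm, neg_sub]
    · simp only [and_comm, sub_self]
    · simp [sub_mul, Pi.single_apply, ite_and]
  · exact IsKoszul.zero m
  · exact fun _ _ _ _ => IsKoszul.add
  · rintro c x _ ⟨A, a1, a2, a3, a4⟩
    refine ⟨fun j k => c * A j k, fun j k => ?_, fun j => ?_, fun j k hk => ?_, fun j => ?_⟩
    · dsimp only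
      rw [a1 j k, mul_neg]
    · simp [a2]
    · simp [a3 j k hk]
    · simp [a4 j, Finset.mul_sum, mul_assoc]

theorem KoszulExact.comp_perm (h : KoszulExact F m) (π : Equiv.Perm (Fin m)) :
    KoszulExact (F ∘ π) m := by
  intro H hH _
  obtain ⟨A, a1, a2, a3, a4⟩ := h (H ∘ π.symm)
    (by
      rw [← hH, ← Equiv.sum_comp π]
      simp) (fun j hj => absurd j.2 (not_lt.2 hj))
  refine ⟨fun j k => A (π j) (π k), fun j k => a1 _ _, fun j => a2 _,
    fun j k hk => absurd k.2 (not_lt.2 hk), fun j => ?_⟩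
  have := a4 (π j)
  rw [← Equiv.sum_comp π] at this
  simpa using this

/-- For a sorted list of homogeneous polynomials without nontrivial syzygies, the last component
of a syzygy lies in the ideal of the preceding polynomials. -/
theorem KoszulExact.mem_partialIdeal {ord : MonomialOrder (Fin n)} (hex : KoszulExact F m)
    (hF : ∀ i, F i ≠ 0) (hhom : ∀ i, ∃ d, (F i).IsHomogeneous d) (hsort : IsSorted ord F)
    (i : Fin m) (g : Fin m → MvPolynomial (Fin n) K) (hg : ∑ j, g j * F j = 0)
    (hg0 : ∀ j, i < j → g j = 0) : g i ∈ partialIdeal F i := by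
  choose δ hδ using hhom
  have htot : ∀ j, (F j).totalDegree = δ j := fun j => (hδ j).totalDegree (hF j)
  -- A preceding nonzero constant makes the ideal everything, so positive degrees may be assumed
  -- before `i`.
  by_cases hconst : ∃ j < i, δ j = 0
  · obtain ⟨j, hji, hj⟩ := hconst
    have hC := totalDegree_eq_zero_iff_eq_C.1 ((htot j).trans hj)
    have hc : coeff 0 (F j) ≠ 0 := fun h => hF j (by rw [hC, h, C_0])
    have hunit : IsUnit (F j) := by
      rw [hC]
      exact (isUnit_iff_ne_zero.2 hc).map C
    have htop := Ideal.eq_top_of_isUnit_mem (partialIdeal F i)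
      (Ideal.subset_span ⟨j, Fin.lt_def.1 hji, rfl⟩) hunit
    rw [htop]
    trivial
  push Not at hconst
  -- The generator with index `0` precedes `i` and has positive degree; by sorting, all later
  -- degrees are at least as large.
  have hpos : ∀ j, i < j → 0 < i.val → 0 < δ j := by
    intro j hij hi
    have h0 : (⟨0, i.pos⟩ : Fin m) < i := Fin.lt_def.2 hi
    have h1 := hconst _ h0
    have h2 := hsort _ j (h0.trans hij)
    rw [htot, htot] at h2
    omega
  rcases Nat.eq_zero_or_pos i.val with hi | hi
  -- For the first generator no descent is needed: its only syzygy is zero, the ring being a domain.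
  · rw [Finset.sum_eq_single i (fun j _ hj => by
      rw [hg0 j (lt_of_le_of_ne (Fin.le_def.2 (by omega)) hj.symm), zero_mul]) (by simp)] at hg
    rw [(mul_eq_zero.1 hg).resolve_right (hF i)]
    exact Ideal.zero_mem _
  have hdesc : ∀ r l : ℕ, l + r = m → i.val < l → KoszulExact F l := by
    intro r
    induction r with
    | zero =>
      rintro l rfl _
      exact hex
    | succ r ih =>
      intro l hlr hil
      exact KoszulExact.of_succ (l := ⟨l, by omega⟩) hδ (hpos _ (Fin.lt_def.2 hil) hi)
        (ih (l + 1) (by omega) (by omega))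
  -- Row `i` of the matrix for the first `i + 1` members writes `g i` in terms of the generators
  -- before `i`, since the diagonal entry is zero.
  obtain ⟨A, _, a2, a3, a4⟩ := hdesc (m - (i + 1)) (i + 1) (by omega) (Nat.lt_succ_self _) g hg
    (fun j hj => hg0 j (Fin.lt_def.2 hj))
  refine F5.mem_partialIdeal.2 ⟨A i, fun j hj => ?_, (a4 i).symm⟩
  rcases hj.lt_or_eq with hj | hj
  · exact a3 i j hj
  · rw [← Fin.ext hj, a2]

end Koszul

end F5

theorem mainTheorem2 {K : Type*} [Field K] {n m : ℕ} [NeZero m] (ord : MonomialOrder (Fin n))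
    (F : Fin m → MvPolynomial (Fin n) K) (hF : ∀ i, F i ≠ 0)
    (hhom : ∀ i, ∃ d, (F i).IsHomogeneous d) :
    (∀ G : Set (MvPolynomial (Fin n) K), F5.Outputs ord F G →
      IsGroebnerBasis ord G (Ideal.span (Set.range F))) ∧
    ((∀ H : Fin m → MvPolynomial (Fin n) K, IsSyzygy F H →
        H ∈ Submodule.span (MvPolynomial (Fin n) K) (principalSyzygies F)) →
      ¬ F5.ReducesToZero ord F) := by
  constructor
  · rintro G ⟨π, _, hrun⟩
    have := F5.Config.inv_of_reflTransGen (fun i => hF (π i)) hrun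
    change IsGroebnerBasis ord G (Ideal.span (Set.range (F ∘ π))) at this
    rwa [π.surjective.range_comp] at this
  · rintro hsyz ⟨c, ⟨π, hsort, hrun⟩, hzero⟩
    have hex := (F5.koszulExact_of_syzygies hsyz).comp_perm π
    exact (F5.Config.inv_of_reflTransGen (fun i => hF (π i)) hrun).not_isZeroReduction
      (hex.mem_partialIdeal (fun i => hF (π i)) (fun i => hhom (π i)) hsort) hzero
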